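/- **Proposition 3.3.** *The Lie superalgebra.* Let $R=\mathbb C[[x_1,x_2,x_3]]$, let $W_3$ be the Lie algebra of formal vector fields $D=\sum_iP_i\partial_i$ ($P_i\in R$), with divergence $\operatorname{div}D=\sum_i\partial_iP_i$, and let $\Omega^k(3)$ be the formal $k$-forms. Put $\mathrm{vol}=dx_1\wedge dx_2\wedge dx_3$. Identify $2$-forms with vector fields by $\iota_D\mathrm{vol}\leftrightarrow D$ and $3$-forms $f\,\mathrm{vol}$ with functions $f$. Let $\mathbb C^2$ have basis $\varepsilon^+,\varepsilon^-$, with $\varepsilon^+\wedge\varepsilon^-=1$ in $\Lambda^2\mathbb C^2=\mathbb C$, and identify $S^2\mathbb C^2$ with $sl_2$ by letting $v\cdot v'$ act on $\mathbb C^2$ as $w\mapsto\frac12((v\wedge w)v'+(v'\wedge w)v)$. Let $L=E(3,8)$ be the Lie superalgebra with $$L_{\bar0}=W_3\oplus(R\otimes sl_2)\oplus d\Omega^1(3),\qquad L_{\bar1}=(\Omega^0(3)\otimes\mathbb C^2)\oplus(\Omega^2(3)\otimes\mathbb C^2)$$ and the following brackets, for $D,D'\in W_3$, $g,g'\in R\otimes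 sl_2$, $\theta,\theta'\in d\Omega^1(3)$, $f,h\in R$, $v,v'\in\mathbb C^2$, $\omega,\omega'\in\Omega^2(3)$ ($L_D$ is the Lie derivative): * $[D,D']=[D,D']_{W_3}-\frac12d(\operatorname{div}D)\wedge d(\operatorname{div}D')$, $[D,g]=D(g)$, $[D,\theta]=L_D\theta$, $[g,g']=gg'-g'g+\operatorname{tr}(dg\wedge dg')$, $[g,\theta]=[\theta,\theta']=0$; * $[D,f\otimes v]=(Df-\frac12(\operatorname{div}D)f)\otimes v+\frac12(d(\operatorname{div}D)\wedge df)\otimes v$, $[g,f\otimes v]=f\,gv+dg\wedge df\,v$, $[\theta,f\otimes v]=f\theta\otimes v$; * $[D,\omega\otimes v]=(L_D\omega-\frac12(\operatorname{div}D)\omega)\otimes v$, $[g,\omega\otimes v]=\omega\,gv$, $[\theta,\omega\otimes v]=0$; * $[f\otimes v,h\otimes v']=-(v\wedge v')\,df\wedge dh\in W_3$; * $[f\otimes v,\omega\otimes v']=-(v\wedge v')f\omega-(df\wedge\omega-f\,d\omega)(v\cdot v')+(v\wedge v')\,d(d\omega)\wedge df$, whose three terms lie in $W_3$, $R\otimes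 sl_2$, $d\Omega^1(3)$; * $[\iota_D\mathrm{vol}\otimes v,\iota_{D'}\mathrm{vol}\otimes v']=(v\wedge v')\,d(\iota_{D'}\iota_D\mathrm{vol})\in d\Omega^1(3)$. Grade $L$ by $\deg x_i=-\deg\partial_i=\deg dx_i=2$, $\deg\varepsilon^\pm=-3$, $\deg sl_2=0$; write $\mathfrak g_j$ for the component of degree $j$, $L_0=\prod_{j\ge0}\mathfrak g_j$, $L_+=\prod_{j>0}\mathfrak g_j$. Then $\mathfrak g_0=gl_3\oplus sl_2=sl_3\oplus sl_2\oplus\mathbb CY$, where $gl_3$ is spanned by the $x_i\partial_j$ and $Y=\frac23\sum_ix_i\partial_i$. For a $\mathfrak g_0$-module $V$, on which $L_+$ acts by zero, let $M(V)=U(L)\otimes_{U(L_0)}V$. *The modules.* Let $H$ be the associative algebra of polynomial differential operators in $x_1,x_2,x_3,z_+,z_-$, with $\partial_a=\partial/\partial z_a$ for $a=\pm$. Let $\mathfrak g_0$ act on left $H$-modules through the Lie algebra map $\mathfrak g_0\to H$ which is the natural one on $sl_3\oplus sl_2$ (acting on the variables $x_i$ and $z_a$ respectively) and sends $Y$ to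 $-\frac43\sum_ix_i\partial_i+\sum_az_a\partial_a$. Let $V_X=H\mathbf 1_X$ be $H$ modulo the left ideal generated by, that is, with $\mathbf 1_X$ killed by, $$\partial_i,\partial_a\ (X=A);\qquad \partial_i,z_a\ (X=B);\qquad x_i,\partial_a\ (X=C);\qquad x_i,z_a\ (X=D).$$ Let $V_{X'}=\mathbb C[x_1,x_2,x_3]\mathbf 1_X$ for $X=A,B$ and $V_{X'}=\mathbb C[\partial_1,\partial_2,\partial_3]\mathbf 1_X$ for $X=C,D$; these are $\mathfrak g_0$-submodules of $V_X$. For $X=A,C$ let $V_X^{(1)}\subset V_X$ be the $\mathfrak g_0$-submodule of elements that are linear in $z_+,z_-$. Put $M_X=M(V_X)$, $M_{X'}=M(V_{X'})$, and let $d_i^\pm=x_i\otimes\varepsilon^\pm\in\mathfrak g_{-1}$, $$\nabla=\sum_{i=1}^3\sum_{a=\pm}d_i^a\otimes\partial_i\partial_a,\qquad\Delta^\pm=\sum_{i=1}^3d_i^\pm\otimes\partial_i,\qquad\nabla_2=\Delta^-\Delta^+=\sum_{i,j}d_i^-d_j^+\otimes\partial_i\partial_j .$$ *Statement.* (a) The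 rule $u\otimes f\mathbf 1_A\mapsto\sum_{i,j}u\,d_i^-d_j^+\otimes(\partial_i\partial_jf)\mathbf 1_B$, for $u\in U(L)$ and $f\in\mathbb C[x_1,x_2,x_3]$, and the rule $u\otimes f\mathbf 1_C\mapsto\sum_{i,j}u\,d_i^-d_j^+\otimes(\partial_i\partial_jf)\mathbf 1_D$, for $u\in U(L)$ and $f\in\mathbb C[\partial_1,\partial_2,\partial_3]$, define morphisms $\nabla_2:M_{A'}\to M_{B'}$ and $\nabla_2:M_{C'}\to M_{D'}$ of $E(3,8)$-modules. (b) The rule $u\otimes v\mapsto\sum_{i,a}u\,d_i^a\otimes\partial_i\partial_av$ defines a morphism $\nabla:M_X\to M_X$ of $E(3,8)$-modules for $X=A,B,C,D$. For $X=A,C$ it restricts to a morphism $M(V_X^{(1)})\to M_{X'}$. Moreover $\nabla\nabla_2=0$, as maps $M_{A'}\to M_B$ and $M_{C'}\to M_D$, and $\nabla_2\nabla=0$, as maps $M(V_A^{(1)})\to M_{B'}$ and $M(V_C^{(1)})\to M_{D'}$. -/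

import Mathlib

open scoped TensorProduct

noncomputable section

namespace Exceptional

attribute [local instance] LieRing.ofAssociativeRing
attribute [local instance] LieAlgebra.ofAssociativeAlgebra

/-! ### Vector calculus over formal power series in three indeterminates

A triple `(P₁, P₂, P₃)` of power series (indices are `0, 1, 2` in the code) stands for any of
* the vector field `D = ∑ Pᵢ ∂ᵢ`;
* the one-form `∑ Pᵢ dxᵢ`;
* the two-form `ι_D (dx₁∧dx₂∧dx₃) = P₁ dx₂∧dx₃ + P₂ dx₃∧dx₁ + P₃ dx₁∧dx₂`.
Three-forms `f dx₁∧dx₂∧dx₃` are identified with their coefficient `f`. -/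

/-- Formal power series `ℂ[[x₁, x₂, x₃]]`. -/
abbrev R := MvPowerSeries (Fin 3) ℂ

/-- Coefficients of a vector field, a one-form or a two-form. -/
abbrev Triple := Fin 3 → R

/-- `∂/∂xᵢ`. -/
def pd (i : Fin 3) : Derivation ℂ R R := MvPowerSeries.pderiv ℂ i

/-- The vector field `D` applied to the function `f`; also the coefficient of `df ∧ ω`
for the two-form `ω` with the same coefficients as `D`. -/
def app (D : Triple) (f : R) : R := ∑ i, D i * pd i f

/-- The divergence of a vector field; also the coefficient of `dω` for a two-form `ω`. -/
def dv (D : Triple) : R := ∑ i, pd i (D i)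

/-- The one-form `df`. -/
def grad (f : R) : Triple := fun i => pd i f

/-- The two-form `α ∧ β` of two one-forms. The same coefficients are those of the one-form
`ι_E ι_D (dx₁∧dx₂∧dx₃)` when `α`, `β` are read as vector fields `D`, `E`. -/
def wedge (α β : Triple) : Triple :=
  ![α 1 * β 2 - α 2 * β 1, α 2 * β 0 - α 0 * β 2, α 0 * β 1 - α 1 * β 0]

/-- The two-form `dα` of a one-form `α`. -/
def curl (α : Triple) : Triple :=
  ![pd 1 (α 2) - pd 2 (α 1), pd 2 (α 0) - pd 0 (α 2), pd 0 (α 1) - pd 1 (α 0)]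

/-- The Lie bracket of vector fields. -/
def vb (D E : Triple) : Triple := fun i => app D (E i) - app E (D i)

/-- The Lie derivative `L_D ω` of a two-form: for `ω = ι_E vol` one has
`L_D (ι_E vol) = ι_[D,E] vol + (div D) ι_E vol`. -/
def lieForm (D ω : Triple) : Triple := vb D ω + dv D • ω

/-! ### The Lie superalgebra `E(3,8)`

Even part: `W₃ + Ω⁰(3) ⊗ sl₂ + dΩ¹(3)`.
Odd part: `Ω⁰(3)^{-1/2} ⊗ ℂ² + Ω²(3)^{-1/2} ⊗ ℂ²`.
The basis `ε⁺, ε⁻` of `ℂ²` is indexed by `0, 1 : Fin 2`. -/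

/-- The ambient space in which `E(3,8)` is cut out by linear equations. -/
abbrev Ambient :=
  Triple × Matrix (Fin 2) (Fin 2) R × Triple × (Fin 2 → R) × (Fin 2 → Triple)

/-- The component in `W₃`. -/
abbrev vec (x : Ambient) : Triple := x.1
/-- The component in `Ω⁰(3) ⊗ gl₂`. -/
abbrev mat (x : Ambient) : Matrix (Fin 2) (Fin 2) R := x.2.1
/-- The component in the (even) two-forms. -/
abbrev frm (x : Ambient) : Triple := x.2.2.1
/-- The component in `Ω⁰(3) ⊗ ℂ²`: coefficients `u_a` of `∑ u_a ⊗ ε^a`. -/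
abbrev odd0 (x : Ambient) : Fin 2 → R := x.2.2.2.1
/-- The component in `Ω²(3) ⊗ ℂ²`: coefficients `w_a` of `∑ w_a ⊗ ε^a`. -/
abbrev odd2 (x : Ambient) : Fin 2 → Triple := x.2.2.2.2

/-- `area a b = ε^a ∧ ε^b` in `Λ²ℂ² = ℂ`, normalised by `ε⁺ ∧ ε⁻ = 1`. -/
def area : Matrix (Fin 2) (Fin 2) ℂ := !![0, 1; -1, 0]

/-- `symSq a b = ε^a · ε^b` in `S²ℂ² = sl₂`, where `v · v'` acts on `ℂ²` by
`w ↦ ((v ∧ w) v' + (v' ∧ w) v) / 2`. -/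
def symSq (a b : Fin 2) : Matrix (Fin 2) (Fin 2) ℂ := fun i j =>
  (1 / 2 : ℂ) * (area a j * (if i = b then 1 else 0) + area b j * (if i = a then 1 else 0))

/-- The `Ω⁰`-part of the action of the even part of `x` on the odd element `u = ∑ u_a ⊗ ε^a`:
`D u - (div D) u / 2 + g u`. -/
def act0 (x : Ambient) (u : Fin 2 → R) : Fin 2 → R := fun a =>
  app (vec x) (u a) - (1 / 2 : ℂ) • (dv (vec x) * u a) + ∑ b, mat x a b * u b

/-- The `Ω²`-part of the action of the even part `D + g + θ` of `x` on the odd element `u + w`: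
`L_D w - (div D) w / 2 + g w + d(div D) ∧ du / 2 + dg ∧ du + u θ`. -/
def act2 (x : Ambient) (u : Fin 2 → R) (w : Fin 2 → Triple) : Fin 2 → Triple := fun a =>
  lieForm (vec x) (w a) - (1 / 2 : ℂ) • dv (vec x) • w a + ∑ b, mat x a b • w b
    + (1 / 2 : ℂ) • wedge (grad (dv (vec x))) (grad (u a))
    + ∑ b, wedge (grad (mat x a b)) (grad (u b)) + u a • frm x

/-- The bracket of the even parts:
`[D, D'] = [D, D']_{W₃} - d(div D) ∧ d(div D') / 2`, `[D, g] = D(g)`, `[D, θ] = L_D θ`,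
`[g, g'] = g g' - g' g + tr(dg ∧ dg')`, and `θ` commutes with `g'` and `θ'`. -/
def evenBr (x y : Ambient) : Ambient :=
  (vb (vec x) (vec y),
   mat x * mat y - mat y * mat x + (mat y).map (app (vec x)) - (mat x).map (app (vec y)),
   lieForm (vec x) (frm y) - lieForm (vec y) (frm x)
     - (1 / 2 : ℂ) • wedge (grad (dv (vec x))) (grad (dv (vec y)))
     + ∑ a, ∑ b, wedge (grad (mat x a b)) (grad (mat y b a)),
   0, 0)

/-- The bracket of the odd parts:
`[f ⊗ v, g ⊗ v'] = -(df ∧ dg) (v ∧ v')` in `W₃`,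
`[f ⊗ v, ω ⊗ v'] = -(f ω) (v ∧ v') - (df ∧ ω - f dω) (v · v') + (d(dω) ∧ df) (v ∧ v')`
in `W₃`, `Ω⁰ ⊗ sl₂`, `dΩ¹` respectively, where the three-form `dω` is read as a function, and
`[ω ⊗ v, ω' ⊗ v'] = d(ι_{D'} ι_D vol) (v ∧ v')` in `dΩ¹` for `ω = ι_D vol`, `ω' = ι_{D'} vol`. -/
def oddBr (x y : Ambient) : Ambient :=
  (- ∑ a, ∑ b, area a b • (wedge (grad (odd0 x a)) (grad (odd0 y b))
       + odd0 x a • odd2 y b + odd0 y a • odd2 x b),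
   - ∑ a, ∑ b, (symSq a b).map fun c => c •
       ((app (odd2 y b) (odd0 x a) - odd0 x a * dv (odd2 y b))
         + (app (odd2 x b) (odd0 y a) - odd0 y a * dv (odd2 x b))),
   ∑ a, ∑ b, area a b • (wedge (grad (dv (odd2 y b))) (grad (odd0 x a))
       + wedge (grad (dv (odd2 x b))) (grad (odd0 y a))
       + curl (wedge (odd2 x a) (odd2 y b))),
   0, 0)

/-- The brackets of the even part of one argument with the odd part of the other. -/
def mixBr (x y : Ambient) : Ambient :=
  (0, 0, 0, act0 x (odd0 y) - act0 y (odd0 x),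
    act2 x (odd0 y) (odd2 y) - act2 y (odd0 x) (odd2 x))

/-- The superbracket, as a bilinear operation. -/
def br (x y : Ambient) : Ambient := evenBr x y + oddBr x y + mixBr x y

theorem pd_comm (i j : Fin 3) (f : R) : pd i (pd j f) = pd j (pd i f) := by
  ext n
  simp only [pd, MvPowerSeries.coeff_pderiv]
  rw [add_right_comm]
  by_cases h : i = j
  · subst h; ring
  · simp [h, Ne.symm h]
    ring

theorem dv_zero : dv 0 = 0 := by simp [dv]

theorem dv_add (D E : Triple) : dv (D + E) = dv D + dv E := by
  simp [dv, Finset.sum_add_distrib]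

theorem dv_sub (D E : Triple) : dv (D - E) = dv D - dv E := by
  simp [dv, Finset.sum_sub_distrib]

theorem dv_smul (c : ℂ) (D : Triple) : dv (c • D) = c • dv D := by
  simp [dv, Finset.smul_sum]

theorem dv_curl (α : Triple) : dv (curl α) = 0 := by
  simp [dv, curl, Fin.sum_univ_three, pd_comm 1 0, pd_comm 2 0, pd_comm 2 1]

theorem dv_wedge_grad (f g : R) : dv (wedge (grad f) (grad g)) = 0 := by
  simp [dv, wedge, grad, Fin.sum_univ_three, pd_comm 1 0, pd_comm 2 0, pd_comm 2 1]
  ring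

theorem dv_lieForm (D ω : Triple) (h : dv ω = 0) : dv (lieForm D ω) = 0 := by
  have h1 : dv (lieForm D ω) = app D (dv ω) + dv D * dv ω := by
    simp [lieForm, vb, dv, app, Fin.sum_univ_three, pd_comm 1 0, pd_comm 2 0, pd_comm 2 1]
    ring
  rw [h1, h]
  simp [app]

theorem app_add (D : Triple) (f g : R) : app D (f + g) = app D f + app D g := by
  simp [app, mul_add, Finset.sum_add_distrib]

/-- The underlying space of the Lie superalgebra `E(3,8)`: the matrix component is traceless and
the even two-form is closed (equivalently, exact). -/
def E38 : Submodule ℂ Ambient where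
  carrier := {x | (mat x).trace = 0 ∧ dv (frm x) = 0}
  add_mem' := by
    rintro x y ⟨h1, h2⟩ ⟨h3, h4⟩
    refine ⟨?_, ?_⟩
    · change (mat x + mat y).trace = 0
      rw [Matrix.trace_add, h1, h3, add_zero]
    · change dv (frm x + frm y) = 0
      rw [dv_add, h2, h4, add_zero]
  zero_mem' := ⟨Matrix.trace_zero .., dv_zero⟩
  smul_mem' := by
    rintro c x ⟨h1, h2⟩
    refine ⟨?_, ?_⟩
    · change (c • mat x).trace = 0
      rw [Matrix.trace_smul, h1, smul_zero]
    · change dv (c • frm x) = 0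
      rw [dv_smul, h2, smul_zero]

theorem br_mem {x y : Ambient} (hx : x ∈ E38) (hy : y ∈ E38) : br x y ∈ E38 := by
  obtain ⟨hx1, hx2⟩ := hx
  obtain ⟨hy1, hy2⟩ := hy
  rw [Matrix.trace_fin_two] at hx1 hy1
  have ax : ∀ D, app D (mat x 0 0) + app D (mat x 1 1) = 0 := fun D => by
    rw [← app_add, hx1]; simp [app]
  have ay : ∀ D, app D (mat y 0 0) + app D (mat y 1 1) = 0 := fun D => by
    rw [← app_add, hy1]; simp [app]
  constructor
  · have e1 : (mat (evenBr x y)).trace = 0 := by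
      simp only [evenBr, mat, Matrix.trace_sub, Matrix.trace_add]
      rw [Matrix.trace_mul_comm, sub_self, zero_add, Matrix.trace_fin_two, Matrix.trace_fin_two]
      simp only [Matrix.map_apply]
      rw [ax, ay, sub_zero]
    have e2 : (mat (oddBr x y)).trace = 0 := by
      simp [oddBr, mat, Matrix.trace_fin_two, Fin.sum_univ_two, symSq, area]
      abel
    have e3 : (mat (mixBr x y)).trace = 0 := Matrix.trace_zero ..
    change (mat (evenBr x y) + mat (oddBr x y) + mat (mixBr x y)).trace = 0
    rw [Matrix.trace_add, Matrix.trace_add, e1, e2, e3]; simp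
  · have e1 : dv (frm (evenBr x y)) = 0 := by
      simp [evenBr, frm, dv_add, dv_sub, dv_smul, dv_wedge_grad, dv_lieForm _ _ hx2,
        dv_lieForm _ _ hy2]
    have e2 : dv (frm (oddBr x y)) = 0 := by
      simp [oddBr, frm, dv_add, dv_smul, dv_wedge_grad, dv_curl]
    have e3 : dv (frm (mixBr x y)) = 0 := dv_zero
    change dv (frm (evenBr x y) + frm (oddBr x y) + frm (mixBr x y)) = 0
    rw [dv_add, dv_add, e1, e2, e3]; simp

/-- The superbracket of `E(3,8)`. -/
def bracket (x y : E38) : E38 := ⟨br x y, br_mem x.2 y.2⟩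

/-- The even part of `E(3,8)`. -/
def evenPart : Set E38 := {x | odd0 x.1 = 0 ∧ odd2 x.1 = 0}

/-- The odd part of `E(3,8)`. -/
def oddPart : Set E38 := {x | vec x.1 = 0 ∧ mat x.1 = 0 ∧ frm x.1 = 0}

/-- The filtration `∏_{k ≥ j} g_k` attached to the grading of depth `3` with
`deg xᵢ = -deg ∂ᵢ = deg dxᵢ = 2`, `deg ε^± = -3`, `deg sl₂ = 0`. -/
def fil (j : ℤ) : Set E38 := {x |
  (∀ i n, 2 * (n.degree : ℤ) - 2 < j → MvPowerSeries.coeff n (vec x.1 i) = 0) ∧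
  (∀ a b n, 2 * (n.degree : ℤ) < j → MvPowerSeries.coeff n (mat x.1 a b) = 0) ∧
  (∀ i n, 2 * (n.degree : ℤ) + 4 < j → MvPowerSeries.coeff n (frm x.1 i) = 0) ∧
  (∀ a n, 2 * (n.degree : ℤ) - 3 < j → MvPowerSeries.coeff n (odd0 x.1 a) = 0) ∧
  (∀ a i n, 2 * (n.degree : ℤ) + 1 < j → MvPowerSeries.coeff n (odd2 x.1 a i) = 0)}

/-- The subalgebra `L₀ = g₀ + L₊`. -/
def L0 : Set E38 := fil 0

/-! ### The universal enveloping superalgebra -/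

/-- The defining relations `x y - (-1)^{|x||y|} y x = [x, y]` of the universal enveloping
superalgebra. (Those with `x` odd and `y` even follow from those with `x` even and `y` odd.) -/
inductive Rel : TensorAlgebra ℂ E38 → TensorAlgebra ℂ E38 → Prop
  | even (x y : E38) (hx : x ∈ evenPart) :
      Rel (TensorAlgebra.ι ℂ x * TensorAlgebra.ι ℂ y - TensorAlgebra.ι ℂ y * TensorAlgebra.ι ℂ x)
        (TensorAlgebra.ι ℂ (bracket x y))
  | odd (x y : E38) (hx : x ∈ oddPart) (hy : y ∈ oddPart) :
      Rel (TensorAlgebra.ι ℂ x * TensorAlgebra.ι ℂ y + TensorAlgebra.ι ℂ y * TensorAlgebra.ι ℂ x)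
        (TensorAlgebra.ι ℂ (bracket x y))

/-- The universal enveloping superalgebra `U(E(3,8))`. An `E(3,8)`-module is a `U`-module. -/
def U : Type := RingQuot Rel

instance : Ring U := inferInstanceAs (Ring (RingQuot Rel))
instance : Algebra ℂ U := inferInstanceAs (Algebra ℂ (RingQuot Rel))

/-- The canonical map `E(3,8) → U(E(3,8))`. -/
def ι : E38 →ₗ[ℂ] U :=
  (RingQuot.mkAlgHom ℂ Rel).toLinearMap.comp (TensorAlgebra.ι ℂ)

/-! ### The Lie algebra `g₀` and induced modules -/

/-- `g₀ = gl₃ ⊕ sl₂ = sl₃ ⊕ sl₂ ⊕ ℂY`: the matrix unit `E_{ij}` of `gl₃` is the vector field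
`xᵢ ∂ⱼ`, and `Y = (2/3) ∑ xᵢ ∂ᵢ`. -/
abbrev g0 : Type := Matrix (Fin 3) (Fin 3) ℂ × LieAlgebra.SpecialLinear.sl (Fin 2) ℂ

instance : LieRing g0 := inferInstanceAs
  (LieRing (Matrix (Fin 3) (Fin 3) ℂ × LieAlgebra.SpecialLinear.sl (Fin 2) ℂ))
instance : LieAlgebra ℂ g0 := inferInstanceAs
  (LieAlgebra ℂ (Matrix (Fin 3) (Fin 3) ℂ × LieAlgebra.SpecialLinear.sl (Fin 2) ℂ))

/-- The degree zero component of an element; on `L₀` this is the projection `L₀ → L₀ / L₊ = g₀`. -/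
def degZero (x : E38) : g0 :=
  (Matrix.of fun i j => MvPowerSeries.coeff (Finsupp.single i 1) (vec x.1 j),
   ⟨(mat x.1).map MvPowerSeries.constantCoeff, by
      have h : (mat x.1).trace = 0 := x.2.1
      rw [Matrix.trace_fin_two] at h
      change Matrix.trace ((mat x.1).map MvPowerSeries.constantCoeff) = 0
      rw [Matrix.trace_fin_two, Matrix.map_apply, Matrix.map_apply, ← map_add, h, map_zero]⟩)

section Induced

variable (V W : Type) [AddCommGroup V] [Module ℂ V] [LieRingModule g0 V] [LieModule ℂ g0 V]
  [AddCommGroup W] [Module ℂ W] [LieRingModule g0 W] [LieModule ℂ g0 W]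

/-- The relations `x ⊗ v = 1 ⊗ x v` for `x ∈ L₀`, where `L₊` acts trivially on `V`. -/
def indRel : Submodule U (U ⊗[ℂ] V) :=
  Submodule.span U {t | ∃ x ∈ L0, ∃ v : V, t = ι x ⊗ₜ[ℂ] v - 1 ⊗ₜ[ℂ] ⁅degZero x, v⁆}

/-- The induced module `M(V) = U(L) ⊗_{U(L₀)} V` for `L = E(3,8)`. -/
def M : Type := (U ⊗[ℂ] V) ⧸ indRel V

instance : AddCommGroup (M V) := inferInstanceAs (AddCommGroup ((U ⊗[ℂ] V) ⧸ indRel V))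
instance : Module U (M V) := inferInstanceAs (Module U ((U ⊗[ℂ] V) ⧸ indRel V))

/-- The projection `U(L) ⊗ V → M(V)`. -/
def toM : U ⊗[ℂ] V →ₗ[U] M V := (indRel V).mkQ

variable {V W}

/-- The functor `M` on morphisms of `g₀`-modules. -/
def M.map (f : V →ₗ⁅ℂ, g0⁆ W) : M V →ₗ[U] M W :=
  Submodule.mapQ (indRel V) (indRel W)
    (TensorProduct.AlgebraTensorModule.map LinearMap.id (f : V →ₗ[ℂ] W)) <| by
      refine Submodule.span_le.mpr ?_
      rintro _ ⟨x, hx, v, rfl⟩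
      refine Submodule.subset_span ⟨x, hx, f v, ?_⟩
      simp

/-- For `Φ = ∑ uₘ ⊗ ℓₘ` with `ℓₘ : V → W`, the element `Φ(v) = ∑ uₘ ⊗ ℓₘ(v)` of `M(W)`. -/
def evalAt (Φ : U ⊗[ℂ] (V →ₗ[ℂ] W)) (v : V) : M W :=
  toM W (LinearMap.lTensor U (LinearMap.applyₗ v) Φ)

/-- `φ : M(V) → M(V')` is given by the rule `φ(u ⊗ v) = u Φ(j v)`, where `j : V → W` is a linear
map used to regard elements of `V` as elements of `W`. -/
def GivenBy (φ : M V →ₗ[U] M W) (Φ : U ⊗[ℂ] (W →ₗ[ℂ] W)) (j : V →ₗ[ℂ] W) : Prop :=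
  ∀ (u : U) (v : V), φ (toM V (u ⊗ₜ[ℂ] v)) = u • evalAt Φ (j v)

end Induced

/-! ### The oscillator modules `V_X` -/

/-- The four types of `g₀`-invariant Lagrangian subspaces `L_X` of the symplectic space with basis
`xᵢ, z_a, ∂ᵢ, ∂_a`. -/
inductive Quadrant
  | A | B | C | D

/-- Index set of the five coordinates: `inl i` for `xᵢ`, `inr a` for `z_a` (`0` is `+`, `1` is
`-`). -/
abbrev Idx := Fin 3 ⊕ Fin 2

/-- Whether `L_X` contains the coordinate itself (`true`) or the corresponding derivative (`false`):
`L_A = ⟨xᵢ, z_a⟩`, `L_B = ⟨xᵢ, ∂_a⟩`, `L_C = ⟨∂ᵢ, z_a⟩`, `L_D = ⟨∂ᵢ, ∂_a⟩`. -/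
def Quadrant.has : Quadrant → Idx → Bool
  | A, _ => true
  | B, Sum.inl _ => true
  | B, Sum.inr _ => false
  | C, Sum.inl _ => false
  | C, Sum.inr _ => true
  | D, _ => false

/-- Polynomials in five variables. -/
abbrev Poly := MvPolynomial Idx ℂ

/-- `V_X = H / H L'_X = S(L_X) 1_X`, where `H` is the Heisenberg (Weyl) algebra of polynomial
differential operators in `xᵢ, z_a`: the variable with index `inl i` is the one among `xᵢ`, `∂ᵢ`
that lies in `L_X`, the variable with index `inr a` is the one among `z_a`, `∂_a` that lies in
`L_X`, and the polynomial `1` is `1_X`. -/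
def Osc : Type := Poly

instance : AddCommGroup Osc := inferInstanceAs (AddCommGroup Poly)
instance : Module ℂ Osc := inferInstanceAs (Module ℂ Poly)

/-- The space `Osc` regarded as `V_X`; it carries the action of `g₀` that depends on `X`. -/
def V (_ : Quadrant) : Type := Osc

instance (X : Quadrant) : AddCommGroup (V X) := inferInstanceAs (AddCommGroup Osc)
instance (X : Quadrant) : Module ℂ (V X) := inferInstanceAs (Module ℂ Osc)

/-- Multiplication by a variable. -/
def mulVar (s : Idx) : Module.End ℂ Osc where
  toFun := fun f : Poly => MvPolynomial.X s * f
  map_add' := mul_add (MvPolynomial.X s : Poly)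
  map_smul' c := fun f : Poly => mul_smul_comm c (MvPolynomial.X s) f

/-- Differentiation with respect to a variable. -/
def derVar (s : Idx) : Module.End ℂ Osc where
  toFun := fun f : Poly => MvPolynomial.pderiv s f
  map_add' := map_add (MvPolynomial.pderiv s)
  map_smul' c := fun f : Poly => (MvPolynomial.pderiv s).map_smul c f

/-- The coordinates `xᵢ`, `z_a` of `H` acting on `V_X`. -/
def coordOp (X : Quadrant) (s : Idx) : Module.End ℂ Osc :=
  if X.has s then mulVar s else -derVar s

/-- The derivatives `∂ᵢ`, `∂_a` of `H` acting on `V_X`. -/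
def delOp (X : Quadrant) (s : Idx) : Module.End ℂ Osc :=
  if X.has s then derVar s else mulVar s

theorem pderiv_mul_same (s : Idx) (f : Poly) :
    MvPolynomial.pderiv s (MvPolynomial.X s * f) =
      MvPolynomial.X s * MvPolynomial.pderiv s f + f := by
  simp

theorem pderiv_mul_ne {s t : Idx} (h : s ≠ t) (f : Poly) :
    MvPolynomial.pderiv s (MvPolynomial.X t * f) =
      MvPolynomial.X t * MvPolynomial.pderiv s f := by
  simp [MvPolynomial.pderiv_X_of_ne (Ne.symm h)]

theorem der_mul (s t : Idx) :
    derVar s * mulVar t = mulVar t * derVar s + if s = t then 1 else 0 := by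
  by_cases h : s = t
  · subst h
    rw [if_pos rfl]
    exact LinearMap.ext fun f => pderiv_mul_same s f
  · rw [if_neg h, add_zero]
    exact LinearMap.ext fun f => pderiv_mul_ne h f

theorem mul_mul (s t : Idx) : mulVar s * mulVar t = mulVar t * mulVar s :=
  LinearMap.ext fun f : Poly =>
    mul_left_comm (MvPolynomial.X s : Poly) (MvPolynomial.X t) f

theorem der_der (s t : Idx) : derVar s * derVar t = derVar t * derVar s := by
  have h : ⁅MvPolynomial.pderiv (R := ℂ) s, MvPolynomial.pderiv (R := ℂ) t⁆ = 0 := by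
    refine MvPolynomial.derivation_ext fun i => ?_
    rw [Derivation.commutator_apply]
    simp only [MvPolynomial.pderiv_X, Derivation.zero_apply]
    by_cases h1 : s = i <;> by_cases h2 : t = i <;> simp [h1, h2]
  refine LinearMap.ext fun f : Poly => ?_
  have h' : ⁅MvPolynomial.pderiv (R := ℂ) s, MvPolynomial.pderiv (R := ℂ) t⁆ f = 0 := by
    rw [h, Derivation.zero_apply]
  rw [Derivation.commutator_apply, sub_eq_zero] at h'
  exact h'

/-- The canonical commutation relations `[∂_s, x_t] = δ_{st}`. -/
theorem delOp_coordOp (X : Quadrant) (s t : Idx) :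
    delOp X s * coordOp X t = coordOp X t * delOp X s + if s = t then 1 else 0 := by
  unfold delOp coordOp
  have h : ∀ s t : Idx, X.has s ≠ X.has t → s ≠ t := fun s t h h' => h (h' ▸ rfl)
  cases hs : X.has s <;> cases ht : X.has t
  · have := der_mul t s
    simp only [Bool.false_eq_true, ↓reduceIte]
    rw [neg_mul, mul_neg, this]
    simp only [eq_comm (a := t)]
    abel
  · simp only [Bool.false_eq_true, ↓reduceIte]
    rw [if_neg (h s t (by simp [hs, ht])), add_zero]
    exact mul_mul s t
  · simp only [Bool.false_eq_true, ↓reduceIte]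
    rw [if_neg (h s t (by simp [hs, ht])), add_zero]
    rw [neg_mul, mul_neg, der_der]
  · simp only [↓reduceIte]
    exact der_mul s t

theorem coordOp_coordOp (X : Quadrant) (s t : Idx) :
    coordOp X s * coordOp X t = coordOp X t * coordOp X s := by
  by_cases h : s = t
  · rw [h]
  unfold coordOp
  have e1 : derVar s * mulVar t = mulVar t * derVar s := by rw [der_mul, if_neg h, add_zero]
  have e2 : derVar t * mulVar s = mulVar s * derVar t := by
    rw [der_mul, if_neg (Ne.symm h), add_zero]
  cases hs : X.has s <;> cases ht : X.has t <;>
    simp only [Bool.false_eq_true, ↓reduceIte]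
  · rw [neg_mul_neg, neg_mul_neg, der_der]
  · rw [neg_mul, mul_neg, e1]
  · rw [neg_mul, mul_neg, e2]
  · exact mul_mul s t

theorem delOp_delOp (X : Quadrant) (s t : Idx) :
    delOp X s * delOp X t = delOp X t * delOp X s := by
  by_cases h : s = t
  · rw [h]
  unfold delOp
  have e1 : derVar s * mulVar t = mulVar t * derVar s := by rw [der_mul, if_neg h, add_zero]
  have e2 : derVar t * mulVar s = mulVar s * derVar t := by
    rw [der_mul, if_neg (Ne.symm h), add_zero]
  cases hs : X.has s <;> cases ht : X.has t <;>
    simp only [Bool.false_eq_true, ↓reduceIte]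
  · exact mul_mul s t
  · exact e2.symm
  · exact e1
  · exact der_der s t

/-- The linear map `gl(5) → H`, `B ↦ ∑ B_{st} x_s ∂_t`, acting on `V_X`. -/
def quad (X : Quadrant) : Matrix Idx Idx ℂ →ₗ[ℂ] Module.End ℂ Osc where
  toFun B := ∑ s, ∑ t, B s t • (coordOp X s * delOp X t)
  map_add' B B' := by simp [add_smul, Finset.sum_add_distrib]
  map_smul' c B := by simp [mul_smul, Finset.smul_sum]

theorem quad_single (X : Quadrant) (s t : Idx) :
    quad X (Matrix.single s t 1) = coordOp X s * delOp X t := by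
  change ∑ s', ∑ t', Matrix.single s t (1 : ℂ) s' t' • (coordOp X s' * delOp X t') = _
  rw [Finset.sum_eq_single s, Finset.sum_eq_single t]
  · simp
  · intro b _ hb
    simp [hb.symm]
  · simp
  · intro b _ hb
    simp [hb.symm]
  · simp

theorem quad_lie (X : Quadrant) (B B' : Matrix Idx Idx ℂ) :
    quad X ⁅B, B'⁆ = ⁅quad X B, quad X B'⁆ := by
  induction B using Matrix.induction_on' with
  | h_zero => simp
  | h_add p q hp hq => rw [add_lie, map_add, map_add, add_lie, hp, hq]
  | h_std_basis i j a =>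
    induction B' using Matrix.induction_on' with
    | h_zero => simp
    | h_add p q hp hq => rw [lie_add, map_add, map_add, lie_add, hp, hq]
    | h_std_basis k l b =>
      have e1 : Matrix.single i j a = a • Matrix.single i j (1 : ℂ) := by simp
      have e2 : Matrix.single k l b = b • Matrix.single k l (1 : ℂ) := by simp
      rw [e1, e2]
      simp only [LieRing.of_associative_ring_bracket, smul_mul_assoc, mul_smul_comm, map_sub,
        map_smul]
      rw [quad_single, quad_single, smul_comm a b, smul_comm a b, ← smul_sub, ← smul_sub,
        ← smul_sub, ← smul_sub]
      congr 2
      have f1 : quad X (Matrix.single i j (1 : ℂ) * Matrix.single k l 1) =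
          if j = k then coordOp X i * delOp X l else 0 := by
        by_cases h : j = k
        · subst h; simp [quad_single]
        · simp [h]
      have f2 : quad X (Matrix.single k l (1 : ℂ) * Matrix.single i j 1) =
          if l = i then coordOp X k * delOp X j else 0 := by
        by_cases h : l = i
        · subst h; simp [quad_single]
        · simp [h]
      rw [f1, f2]
      have g1 : coordOp X i * delOp X j * (coordOp X k * delOp X l) =
          coordOp X i * coordOp X k * (delOp X j * delOp X l) +
            if j = k then coordOp X i * delOp X l else 0 := by
        rw [mul_assoc, ← mul_assoc (delOp X j), delOp_coordOp, add_mul, mul_add]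
        split_ifs <;> simp [mul_assoc]
      have g2 : coordOp X k * delOp X l * (coordOp X i * delOp X j) =
          coordOp X i * coordOp X k * (delOp X j * delOp X l) +
            if l = i then coordOp X k * delOp X j else 0 := by
        rw [coordOp_coordOp X i k, delOp_delOp X j l, mul_assoc, ← mul_assoc (delOp X l), delOp_coordOp,
          add_mul, mul_add]
        split_ifs <;> simp [mul_assoc]
      rw [g1, g2]
      abel

/-- The inclusion `g₀ → gl(5)`, natural on `sl₃ ⊕ sl₂` and sending `Y` to
`Y^♯ = -(4/3) ∑ xᵢ ∂ᵢ + ∑ z_a ∂_a`; on `gl₃ ⊕ sl₂` it is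
`(A, g) ↦ (A - tr A, g + tr A / 2)`. -/
def toGl (p : g0) : Matrix Idx Idx ℂ :=
  Matrix.fromBlocks (p.1 - p.1.trace • 1) 0 0 (p.2.1 + (p.1.trace / 2) • 1)

/-- The action of `g₀` on `V_X`. -/
def rho (X : Quadrant) : g0 →ₗ⁅ℂ⁆ Module.End ℂ Osc where
  toFun p := quad X (toGl p)
  map_add' p q := by
    rw [← map_add]
    congr 1
    change Matrix.fromBlocks (p.1 + q.1 - (p.1 + q.1).trace • (1 : Matrix (Fin 3) (Fin 3) ℂ)) 0 0
      (p.2.1 + q.2.1 + ((p.1 + q.1).trace / 2) • (1 : Matrix (Fin 2) (Fin 2) ℂ)) = _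
    rw [toGl, toGl, Matrix.fromBlocks_add, Matrix.trace_add, add_smul, add_div, add_smul]
    congr 1 <;> abel
  map_smul' c p := by
    rw [RingHom.id_apply, ← map_smul]
    congr 1
    change Matrix.fromBlocks (c • p.1 - (c • p.1).trace • (1 : Matrix (Fin 3) (Fin 3) ℂ)) 0 0
      (c • p.2.1 + ((c • p.1).trace / 2) • (1 : Matrix (Fin 2) (Fin 2) ℂ)) = _
    rw [toGl, Matrix.fromBlocks_smul, Matrix.trace_smul, smul_sub, smul_add, smul_smul, smul_smul,
      smul_zero, smul_zero, smul_eq_mul, mul_div_assoc]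
  map_lie' {p q} := by
    rw [← quad_lie]
    congr 1
    change Matrix.fromBlocks (⁅p.1, q.1⁆ - (⁅p.1, q.1⁆ : Matrix (Fin 3) (Fin 3) ℂ).trace •
      (1 : Matrix (Fin 3) (Fin 3) ℂ)) 0 0
      (⁅p.2.1, q.2.1⁆ + ((⁅p.1, q.1⁆ : Matrix (Fin 3) (Fin 3) ℂ).trace / 2) •
        (1 : Matrix (Fin 2) (Fin 2) ℂ)) = _
    simp only [LieRing.of_associative_ring_bracket]
    have ht : (p.1 * q.1 - q.1 * p.1).trace = 0 := by
      rw [Matrix.trace_sub, Matrix.trace_mul_comm, sub_self]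
    rw [ht, toGl, toGl, Matrix.fromBlocks_multiply, Matrix.fromBlocks_multiply,
      sub_eq_add_neg (Matrix.fromBlocks _ _ _ _), Matrix.fromBlocks_neg, Matrix.fromBlocks_add]
    congr 1
    · simp only [sub_mul, mul_sub, smul_mul_assoc, mul_smul_comm, one_mul, mul_one]
      module
    · simp
    · simp
    · simp only [add_mul, mul_add, smul_mul_assoc, mul_smul_comm, one_mul, mul_one]
      module

instance (X : Quadrant) : LieRingModule g0 (V X) where
  bracket p f := rho X p f
  add_lie p q f := by
    change rho X (p + q) f = rho X p f + rho X q f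
    rw [map_add]; rfl
  lie_add p f g := map_add (rho X p) f g
  leibniz_lie p q f := by
    change rho X p (rho X q f) = rho X ⁅p, q⁆ f + rho X q (rho X p f)
    rw [LieHom.map_lie, LieRing.of_associative_ring_bracket]
    exact (sub_add_cancel (rho X p (rho X q f)) (rho X q (rho X p f))).symm

instance (X : Quadrant) : LieModule ℂ g0 (V X) where
  smul_lie c p f := by
    change rho X (c • p) f = c • rho X p f
    rw [map_smul]; rfl
  lie_smul c p f := map_smul (rho X p) c f

/-- The weight that counts the variables `z_a` or `∂_a`. -/
def wt : Idx → ℕ := Sum.elim (fun _ => 0) (fun _ => 1)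

/-- Homogeneous polynomials of degree `n` in the variables `z_a` or `∂_a`. -/
def homog (n : ℕ) : Submodule ℂ Osc where
  carrier := {f | MvPolynomial.IsWeightedHomogeneous (R := ℂ) wt (f : Poly) n}
  add_mem' hf hg := hf.add hg
  zero_mem' := MvPolynomial.isWeightedHomogeneous_zero ℂ wt n
  smul_mem' c _ hf := (MvPolynomial.weightedHomogeneousSubmodule ℂ wt n).smul_mem c hf

theorem mulVar_mem {n : ℕ} (s : Idx) {f : Osc} (hf : f ∈ homog n) :
    mulVar s f ∈ homog (wt s + n) :=
  (MvPolynomial.isWeightedHomogeneous_X ℂ wt s).mul hf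

theorem derVar_mem {n m : ℕ} (s : Idx) {f : Osc} (hf : f ∈ homog n) (h : m + wt s = n) :
    derVar s f ∈ homog m :=
  MvPolynomial.IsWeightedHomogeneous.pderiv hf h

theorem has_eq (X : Quadrant) {s t : Idx} (h : wt s = wt t) : X.has s = X.has t := by
  rcases s with s | s <;> rcases t with t | t <;> cases X <;>
    simp [wt, Quadrant.has] at h ⊢

theorem coordOp_delOp_mem (X : Quadrant) {n : ℕ} {s t : Idx} (h : wt s = wt t) {f : Osc}
    (hf : f ∈ homog n) :
    (coordOp X s * delOp X t) f ∈ homog n := by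
  unfold coordOp delOp
  rw [← has_eq X h]
  cases X.has s <;> simp only [Bool.false_eq_true, ↓reduceIte]
  · rw [neg_mul]
    exact neg_mem (derVar_mem s (mulVar_mem t hf) (by omega))
  · have e : mulVar s * derVar t = derVar t * mulVar s - if t = s then 1 else 0 := by
      rw [der_mul, add_sub_cancel_right]
    rw [e]
    refine sub_mem (derVar_mem t (mulVar_mem s hf) (by omega)) ?_
    split_ifs
    · exact hf
    · exact zero_mem _

theorem quad_mem (X : Quadrant) {n : ℕ} {B : Matrix Idx Idx ℂ}
    (hB : ∀ s t, wt s ≠ wt t → B s t = 0) {f : Osc} (hf : f ∈ homog n) :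
    quad X B f ∈ homog n := by
  change (∑ s, ∑ t, B s t • (coordOp X s * delOp X t)) f ∈ homog n
  rw [LinearMap.sum_apply]
  refine sum_mem fun s _ => ?_
  rw [LinearMap.sum_apply]
  refine sum_mem fun t _ => ?_
  rw [LinearMap.smul_apply]
  by_cases h : wt s = wt t
  · exact Submodule.smul_mem _ _ (coordOp_delOp_mem X h hf)
  · rw [hB s t h, zero_smul]
    exact zero_mem _

theorem toGl_apply (p : g0) (s t : Idx) (h : wt s ≠ wt t) : toGl p s t = 0 := by
  rcases s with s | s <;> rcases t with t | t <;> simp [wt, toGl] at h ⊢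

/-- The `g₀`-submodule of `V_X` of all `f 1_X` with `f` homogeneous of degree `n` in those
variables `z_a` or `∂_a` that lie in `L_X`; in terms of the bigrading of `V_X` it is
`⨁_m V_X^{m,n}` for `X = A, C` and `⨁_m V_X^{m,-n}` for `X = B, D`. -/
def Vdeg (X : Quadrant) (n : ℕ) : LieSubmodule ℂ g0 (V X) where
  carrier := {f | (f : Osc) ∈ homog n}
  add_mem' := (homog n).add_mem
  zero_mem' := (homog n).zero_mem
  smul_mem' c _ := (homog n).smul_mem c
  lie_mem {p _} hf := quad_mem X (toGl_apply p) hf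

/-- `V_{X'}`: it is `ℂ[x₁, x₂, x₃] 1_X` for `X = A, B` and `ℂ[∂₁, ∂₂, ∂₃] 1_X` for `X = C, D`. -/
abbrev V' (X : Quadrant) : LieSubmodule ℂ g0 (V X) := Vdeg X 0

/-- The operator `∂ᵢ` on `V_{X'}`. -/
def dx' (X : Quadrant) (i : Fin 3) : V' X →ₗ[ℂ] V' X where
  toFun f := ⟨delOp X (Sum.inl i) f.1, by
    have hf : (f.1 : Osc) ∈ homog 0 := f.2
    change delOp X (Sum.inl i) (f.1 : Osc) ∈ homog 0
    unfold delOp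
    split_ifs
    · exact derVar_mem _ hf rfl
    · exact mulVar_mem (Sum.inl i) hf⟩
  map_add' f g := Subtype.ext (map_add (delOp X (Sum.inl i)) f.1 g.1)
  map_smul' c f := Subtype.ext (map_smul (delOp X (Sum.inl i)) c f.1)

/-- The map `f 1_X ↦ f 1_Y`; used for `ℂ[x₁, x₂, x₃] 1_A → ℂ[x₁, x₂, x₃] 1_B` and
`ℂ[∂₁, ∂₂, ∂₃] 1_C → ℂ[∂₁, ∂₂, ∂₃] 1_D`. -/
def transfer (X Y : Quadrant) : V' X →ₗ[ℂ] V' Y where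
  toFun f := ⟨f.1, f.2⟩
  map_add' _ _ := rfl
  map_smul' _ _ := rfl

/-! ### The elements `∇` and `∇₂` -/

/-- The odd element `dᵢ^a = xᵢ ⊗ ε^a` of `g_{-1}`. -/
def d (i : Fin 3) (a : Fin 2) : E38 :=
  ⟨(0, 0, 0, Pi.single a (MvPowerSeries.X i), 0), Matrix.trace_zero .., dv_zero⟩

/-- `∇ = ∑_a Δ^a ∂_a = ∑_{i,a} dᵢ^a ⊗ ∂ᵢ ∂_a` in `U(L) ⊗ End(V_X)`. -/
def nabla (X : Quadrant) : U ⊗[ℂ] (V X →ₗ[ℂ] V X) :=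
  ∑ i, ∑ a, ι (d i a) ⊗ₜ[ℂ]
    (delOp X (Sum.inl i) * delOp X (Sum.inr a) : Module.End ℂ Osc)

/-- `Δ^a = ∑ᵢ dᵢ^a ⊗ ∂ᵢ` in `U(L) ⊗ End(V_{X'})`. -/
def Delta (X : Quadrant) (a : Fin 2) : U ⊗[ℂ] Module.End ℂ (V' X) :=
  ∑ i, ι (d i a) ⊗ₜ[ℂ] dx' X i

/-- `∇₂ = Δ⁻ Δ⁺`, the product being that of the algebra `U(L) ⊗ End(V_{X'})`. -/
def nabla2 (X : Quadrant) : U ⊗[ℂ] Module.End ℂ (V' X) :=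
  Delta X 1 * Delta X 0

end Exceptional

end

open Exceptional

/-! A morphism `M V → M W` is the same as a linear map `F : V → M W` with `x F(v) = F(x̄ v)` for all
`x ∈ L₀`, where `x̄` is the degree zero component of `x` (`exists_hom`). To test this on `F(v) = ∑
dᵢ^a ⊗ ∂ᵢ∂_a v` or `F(f) = ∑ dᵢ⁻ d_j⁺ ⊗ ∂ᵢ∂_j f`, the element `x`, taken even or odd, is commuted to
the right past the `d`'s. Elements of positive degree kill `1 ⊗ w`, so only a few Taylor
coefficients of `x` survive, and all of `L₀` is treated at once without choosing generators of `L₊`.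

For `∇`, an even `x` acts only through `x̄`; the condition is that the `∂ᵢ∂_a` transform dually to
the `dᵢ^a` (`delDel_rho`). For odd `x`, the degree zero component of `[x, dᵢ^a]` is linear in the
second derivatives `q` of the `Ω⁰`-part and the constant terms `w` of the `Ω²`-part (`oddDeg`), and
`∑ [x, dᵢ^a] ∂ᵢ∂_a v` must vanish (`sum_oddDeg_one`). There `q` meets an antisymmetric symbol
contracted with commuting derivatives, while the `w`-terms cancel against the trace corrections in
the embedding `toGl` of `g₀` in `gl(5)`.

For `∇₂`, `sl₂` acts trivially on the elements involved, and `z_a ∂_a` is `0` on `V_{A'}`, `V_{C'}`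
but `-1` on `V_{B'}`, `V_{D'}`. Hence the two `g₀`-actions differ by the trace, which gives `∇₂` the
right weight and supplies the terms needed for odd `x` (`sum_coefD_sub`, `sum_coefD_add`). An even
`x` of degree two also yields a degree zero term, which vanishes by antisymmetry (`sum_oddDeg_two`).

The compositions vanish because `[dᵢ^a, d_j^b]` is antisymmetric in `i, j`: against coefficients
symmetric in `i, j` the operators `Δ^±` anticommute and square to zero (`sum_ι_d_d_anticomm`), and
every product of three of them repeats one. -/

noncomputable section

namespace Exceptional

/-! ### Universal property of induced modules -/

section Universal

variable {V W : Type} [AddCommGroup V] [Module ℂ V] [AddCommGroup W] [Module ℂ W]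
  [LieRingModule g0 W]

instance : Module ℂ (M W) := inferInstanceAs (Module ℂ ((U ⊗[ℂ] W) ⧸ indRel W))

instance : IsScalarTower ℂ U (M W) :=
  inferInstanceAs (IsScalarTower ℂ U ((U ⊗[ℂ] W) ⧸ indRel W))

/-- The element `1 ⊗ v` of `M(W)`. -/
def gen : W →ₗ[ℂ] M W :=
  ((indRel W).mkQ.restrictScalars ℂ).comp (TensorProduct.mk ℂ U W 1)

theorem toM_tmul (u : U) (v : W) : toM W (u ⊗ₜ[ℂ] v) = u • gen v := by
  change toM W (u ⊗ₜ[ℂ] v) = u • toM W (1 ⊗ₜ[ℂ] v)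
  rw [← map_smul, TensorProduct.smul_tmul', smul_eq_mul, mul_one]

theorem ι_smul_gen {x : E38} (hx : x ∈ L0) (v : W) :
    ι x • gen v = gen ⁅degZero x, v⁆ := by
  rw [← toM_tmul, ← sub_eq_zero]
  change toM W _ - toM W (1 ⊗ₜ[ℂ] _) = 0
  rw [← map_sub]
  exact (Submodule.Quotient.mk_eq_zero _).2 (Submodule.subset_span ⟨x, hx, v, rfl⟩)

theorem evalAt_tmul (u : U) (l : V →ₗ[ℂ] W) (v : V) :
    evalAt (u ⊗ₜ[ℂ] l) v = u • gen (l v) := by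
  rw [← toM_tmul]; rfl

theorem evalAt_sum {κ : Type} (s : Finset κ) (Φ : κ → U ⊗[ℂ] (V →ₗ[ℂ] W)) (v : V) :
    evalAt (∑ k ∈ s, Φ k) v = ∑ k ∈ s, evalAt (Φ k) v := by
  simp [evalAt]

variable [LieRingModule g0 V]

theorem M.hom_ext {N : Type} [AddCommGroup N] [Module U N] {φ ψ : M V →ₗ[U] N}
    (h : ∀ v, φ (gen v) = ψ (gen v)) : φ = ψ := by
  refine LinearMap.ext fun m => ?_
  obtain ⟨t, rfl⟩ := Submodule.mkQ_surjective (indRel V) m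
  change φ (toM V t) = ψ (toM V t)
  induction t with
  | zero => simp
  | tmul u v => rw [toM_tmul, map_smul, map_smul, h]
  | add a b ha hb => rw [map_add, map_add, map_add, ha, hb]

/-- The universal property of induced modules. -/
theorem exists_hom (F : V →ₗ[ℂ] M W)
    (h : ∀ x ∈ L0, ∀ v, ι x • F v = F ⁅degZero x, v⁆) :
    ∃ φ : M V →ₗ[U] M W, ∀ v, φ (gen v) = F v := by
  let G : U ⊗[ℂ] V →ₗ[U] M W :=
    TensorProduct.AlgebraTensorModule.lift (LinearMap.toSpanSingleton U (V →ₗ[ℂ] M W) F)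
  have hG : ∀ u v, G (u ⊗ₜ v) = u • F v := fun u v => rfl
  have hr : indRel V ≤ LinearMap.ker G := by
    refine Submodule.span_le.mpr ?_
    rintro _ ⟨x, hx, v, rfl⟩
    simp only [SetLike.mem_coe, LinearMap.mem_ker, map_sub, hG, one_smul, h x hx v, sub_self]
  refine ⟨(indRel V).liftQ G hr, fun v => ?_⟩
  change G (1 ⊗ₜ v) = F v
  rw [hG, one_smul]

theorem M.map_gen [LieModule ℂ g0 V] [LieModule ℂ g0 W] (f : V →ₗ⁅ℂ, g0⁆ W) (v : V) :
    M.map f (gen v) = gen (f v) := rfl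

theorem givenBy_of_gen {φ : M V →ₗ[U] M W} {Φ : U ⊗[ℂ] (W →ₗ[ℂ] W)} {j : V →ₗ[ℂ] W}
    (h : ∀ v, φ (gen v) = evalAt Φ (j v)) : GivenBy φ Φ j := fun u v => by
  rw [toM_tmul, map_smul, h]

end Universal

/-! ### The lowest terms of elements of `E(3,8)` -/

/-- The value of a power series at the origin. -/
def c0 : R →ₐ[ℂ] ℂ where
  __ := (MvPowerSeries.constantCoeff : R →+* ℂ)
  commutes' r := by simp [MvPowerSeries.algebraMap_apply]

theorem c0_apply (f : R) : c0 f = MvPowerSeries.constantCoeff f := rfl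

theorem coeff_zero_eq (f : R) : MvPowerSeries.coeff 0 f = c0 f := rfl

theorem coeff_single_eq (i : Fin 3) (f : R) :
    MvPowerSeries.coeff (Finsupp.single i 1) f = c0 (pd i f) := by
  rw [← coeff_zero_eq, pd, MvPowerSeries.coeff_pderiv]
  simp

theorem pd_X (i j : Fin 3) :
    pd i (MvPowerSeries.X j : R) = if j = i then 1 else 0 := by
  by_cases h : j = i
  · subst h; simp [pd]
  · rw [if_neg h]; exact MvPowerSeries.pderiv_X_of_ne h

theorem c0_X (i : Fin 3) : c0 (MvPowerSeries.X i : R) = 0 := by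
  rw [c0_apply]; simp

/-- Negative degrees occur only in `W₃` (constant fields, degree `-2`) and in the `Ω⁰`-part (degree
`2n - 3`, negative for `n = 0, 1`). -/
theorem mem_L0_iff (x : E38) : x ∈ L0 ↔ (∀ i, c0 (vec x.1 i) = 0) ∧
    (∀ a, c0 (odd0 x.1 a) = 0) ∧ ∀ a i, c0 (pd i (odd0 x.1 a)) = 0 := by
  constructor
  · rintro ⟨h1, -, -, h4, -⟩
    refine ⟨fun i => h1 i 0 (by simp), fun a => h4 a 0 (by simp), fun a i => ?_⟩
    rw [← coeff_single_eq]
    exact h4 a _ (by simp)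
  · rintro ⟨h1, h2, h3⟩
    refine ⟨fun i n hn => ?_, fun a b n hn => ?_, fun i n hn => ?_, fun a n hn => ?_,
      fun a i n hn => ?_⟩
    · have : n = 0 := (Finsupp.degree_eq_zero_iff n).1 (by omega)
      subst this; exact h1 i
    · omega
    · omega
    · by_cases h0 : n.degree = 0
      · have : n = 0 := (Finsupp.degree_eq_zero_iff n).1 h0
        subst this; exact h2 a
      · have h1 : n.degree = 1 := by omega
        obtain ⟨i, rfl⟩ : ∃ i, n = Finsupp.single i 1 := by
          have hs : n ∈ Set.range fun i => Finsupp.single i 1 := by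
            rw [Finsupp.range_single_one]; exact h1
          obtain ⟨i, hi⟩ := hs
          exact ⟨i, hi.symm⟩
        rw [coeff_single_eq]; exact h3 a i
    · omega

theorem degZero_fst (x : E38) (i j : Fin 3) : (degZero x).1 i j = c0 (pd i (vec x.1 j)) :=
  coeff_single_eq i _

theorem degZero_snd (x : E38) (a b : Fin 2) : (degZero x).2.1 a b = c0 (mat x.1 a b) := rfl

theorem g0_ext {p q : g0} (h1 : ∀ i j, p.1 i j = q.1 i j) (h2 : ∀ a b, p.2.1 a b = q.2.1 a b) :
    p = q :=
  Prod.ext (Matrix.ext h1) (Subtype.ext (Matrix.ext h2))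

/-- Odd elements have only components of odd degree. -/
theorem degZero_odd {y : E38} (hy : y ∈ oddPart) : degZero y = 0 := by
  obtain ⟨h1, h2, -⟩ := hy
  refine g0_ext (fun i j => ?_) (fun a b => ?_)
  · rw [degZero_fst, h1]; simp
  · rw [degZero_snd, h2]; simp

/-- The even part of an element. -/
def evenComp (x : E38) : E38 := ⟨(vec x.1, mat x.1, frm x.1, 0, 0), x.2⟩

/-- The odd part of an element. -/
def oddComp (x : E38) : E38 :=
  ⟨(0, 0, 0, odd0 x.1, odd2 x.1), Matrix.trace_zero .., dv_zero⟩

theorem evenComp_add_oddComp (x : E38) : evenComp x + oddComp x = x := by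
  refine Subtype.ext ?_
  change (vec x.1 + 0, mat x.1 + 0, frm x.1 + 0, 0 + odd0 x.1, 0 + odd2 x.1) = x.1
  simp

theorem evenComp_mem (x : E38) : evenComp x ∈ evenPart := ⟨rfl, rfl⟩

theorem oddComp_mem (x : E38) : oddComp x ∈ oddPart := ⟨rfl, rfl, rfl⟩

theorem evenComp_mem_L0 {x : E38} (hx : x ∈ L0) : evenComp x ∈ L0 := by
  rw [mem_L0_iff] at hx ⊢
  exact ⟨hx.1, fun a => map_zero c0, fun a i => by
    change c0 (pd i 0) = 0
    simp⟩

theorem oddComp_mem_L0 {x : E38} (hx : x ∈ L0) : oddComp x ∈ L0 := by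
  rw [mem_L0_iff] at hx ⊢
  exact ⟨fun i => map_zero c0, hx.2.1, hx.2.2⟩

theorem degZero_evenComp (x : E38) : degZero (evenComp x) = degZero x := rfl

theorem d_mem (i : Fin 3) (a : Fin 2) : d i a ∈ oddPart := ⟨rfl, rfl, rfl⟩

theorem ι_even_mul {x : E38} (hx : x ∈ evenPart) (y : E38) :
    ι x * ι y = ι y * ι x + ι (bracket x y) := by
  have h := RingQuot.mkAlgHom_rel ℂ (Rel.even x y hx)
  rw [map_sub, map_mul, map_mul] at h
  exact eq_add_of_sub_eq' h

theorem ι_odd_mul {x y : E38} (hx : x ∈ oddPart) (hy : y ∈ oddPart) :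
    ι x * ι y = ι (bracket x y) - ι y * ι x := by
  have h := RingQuot.mkAlgHom_rel ℂ (Rel.odd x y hx hy)
  rw [map_add, map_mul, map_mul] at h
  exact eq_sub_of_add_eq h

theorem c0_smul (c : ℂ) (f : R) : c0 (c • f) = c * c0 f := by
  rw [map_smul, smul_eq_mul]

theorem app_zero_left (f : R) : app 0 f = 0 := by simp [app]

theorem app_zero_right (D : Triple) : app D 0 = 0 := by simp [app]

theorem vb_zero_right (D : Triple) : vb D 0 = 0 := by
  funext i; simp [vb, app_zero_left, app_zero_right]

theorem vb_zero_left (D : Triple) : vb 0 D = 0 := by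
  funext i; simp [vb, app_zero_left, app_zero_right]

theorem grad_zero : grad 0 = 0 := by funext i; simp [grad]

theorem wedge_zero_left (α : Triple) : wedge 0 α = 0 := by
  funext i; fin_cases i <;> simp [wedge]

theorem wedge_zero_right (α : Triple) : wedge α 0 = 0 := by
  funext i; fin_cases i <;> simp [wedge]

theorem lieForm_zero_right (D : Triple) : lieForm D 0 = 0 := by
  simp [lieForm, vb_zero_right]

theorem lieForm_zero_left (D : Triple) : lieForm 0 D = 0 := by
  simp [lieForm, vb_zero_left, dv_zero]

theorem curl_zero : curl 0 = 0 := by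
  funext i; fin_cases i <;> simp [curl]

/-- The totally antisymmetric symbol. -/
def levi (k l m : Fin 3) : ℂ :=
  if l = k + 1 ∧ m = k + 2 then 1 else if l = k + 2 ∧ m = k + 1 then -1 else 0

theorem c0_wedge_grad_X (α : Triple) (i k : Fin 3) :
    c0 (wedge α (grad (MvPowerSeries.X i)) k) = ∑ l, levi k l i * c0 (α l) := by
  fin_cases i <;> fin_cases k <;>
    simp [wedge, grad, pd_X, levi]

theorem c0_pd_wedge_grad_X (α : Triple) (i k l : Fin 3) :
    c0 (pd l (wedge α (grad (MvPowerSeries.X i)) k)) = ∑ m, levi k m i * c0 (pd l (α m)) := by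
  fin_cases i <;> fin_cases k <;>
    simp [wedge, grad, pd_X, levi]

theorem odd0_d (i : Fin 3) (a b : Fin 2) :
    odd0 (d i a).1 b = if b = a then MvPowerSeries.X i else 0 := by
  change (Pi.single a (MvPowerSeries.X i) : Fin 2 → R) b = _
  rw [Pi.single_apply]

theorem odd2_d (i : Fin 3) (a b : Fin 2) : odd2 (d i a).1 b = 0 := rfl

/-- The matrix of the action of `g₀` on `g₋₁` in the basis `dᵢ^a`: the coefficient of `d_j^b` in
`[p, dᵢ^a]`. -/
def coefD (p : g0) (j : Fin 3) (b : Fin 2) (i : Fin 3) (a : Fin 2) : ℂ :=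
  (if b = a then p.1 j i - (if j = i then p.1.trace / 2 else 0) else 0) +
    if j = i then p.2.1 b a else 0

theorem bracket_mem_oddPart {x y : E38} (hx : x ∈ evenPart) (hy : y ∈ oddPart) :
    bracket x y ∈ oddPart := by
  obtain ⟨hx1, hx2⟩ := hx
  obtain ⟨hy1, hy2, hy3⟩ := hy
  refine ⟨?_, ?_, ?_⟩
  · change vb (vec x.1) (vec y.1) + - _ + 0 = 0
    simp [hx1, hx2, hy1, vb_zero_right, grad_zero, wedge]
  · change mat x.1 * mat y.1 - mat y.1 * mat x.1 + (mat y.1).map _ - (mat x.1).map _ + - _ + 0 = 0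
    simp [hx1, hx2, hy1, hy2, app_zero_right, dv_zero, app_zero_left]
    ext a b
    simp [app_zero_left]
  · change lieForm (vec x.1) (frm y.1) - lieForm (vec y.1) (frm x.1) - _ + _ + _ + 0 = 0
    simp [oddBr, hx1, hx2, hy1, hy2, hy3, dv_zero, grad_zero, wedge_zero_left, wedge_zero_right,
      lieForm_zero_left, lieForm_zero_right, curl_zero]

theorem c0_pd_pd_mul_X (f : R) (i l m : Fin 3) :
    c0 (pd l (pd m (f * MvPowerSeries.X i))) =
      (if m = i then c0 (pd l f) else 0) + if l = i then c0 (pd m f) else 0 := by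
  have h : pd l ((if i = m then 1 else 0 : R)) = 0 := by split_ifs <;> simp
  rw [Derivation.leibniz, smul_eq_mul, smul_eq_mul, map_add, Derivation.leibniz,
    Derivation.leibniz, pd_X, pd_X, h]
  simp only [eq_comm (a := m) (b := i), eq_comm (a := l) (b := i)]
  split_ifs <;> simp [c0_X]

theorem odd0_bracket_d {x : E38} (hx : x ∈ evenPart) (i : Fin 3) (a b : Fin 2) :
    odd0 (bracket x (d i a)).1 b =
      (if b = a then vec x.1 i - (1 / 2 : ℂ) • (dv (vec x.1) * MvPowerSeries.X i) else 0) +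
        mat x.1 b a * MvPowerSeries.X i := by
  obtain ⟨hx1, hx2⟩ := hx
  change 0 + 0 + (act0 x.1 (odd0 (d i a).1) b - act0 (d i a).1 (odd0 x.1) b) = _
  have h0 : act0 (d i a).1 (odd0 x.1) b = 0 := by
    rw [hx1]
    simp [act0, app_zero_right]
  rw [h0]
  by_cases h : b = a
  · simp [act0, odd0_d, h, app, pd_X]
  · simp [act0, odd0_d, h, app_zero_right]

/-- These constant terms have degree one, so they see only the degree two part of `x`. They matter
when `[x, dᵢ^a]` is in turn commuted past a second `d`. -/
theorem odd2_bracket_d {x : E38} (hx : x ∈ evenPart) (i : Fin 3) (a b : Fin 2) (k : Fin 3) :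
    c0 (odd2 (bracket x (d i a)).1 b k) = ∑ l, levi k l i *
      ((if b = a then c0 (pd l (dv (vec x.1))) / 2 else 0) + c0 (pd l (mat x.1 b a))) := by
  obtain ⟨hx1, hx2⟩ := hx
  change c0 (0 + 0 + (act2 x.1 (odd0 (d i a).1) (odd2 (d i a).1) b k -
    act2 (d i a).1 (odd0 x.1) (odd2 x.1) b k)) = _
  have h0 : act2 (d i a).1 (odd0 x.1) (odd2 x.1) b k = 0 := by
    rw [hx1, hx2]
    simp [act2, grad_zero, wedge_zero_right, lieForm_zero_right]
  have h1 : ∀ c : Fin 2, wedge (grad (mat x.1 b c)) (grad (odd0 (d i a).1 c)) =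
      if c = a then wedge (grad (mat x.1 b c)) (grad (MvPowerSeries.X i)) else 0 := by
    intro c
    rw [odd0_d]
    split_ifs <;> simp [grad_zero, wedge_zero_right]
  rw [h0]
  simp only [act2, h1, odd2_d, lieForm_zero_right, smul_zero, Finset.sum_const_zero,
    Finset.sum_ite_eq', Finset.mem_univ, if_true]
  rw [odd0_d]
  by_cases h : b = a
  · simp only [h, if_true]
    simp [c0_wedge_grad_X, c0_X, grad]
    rw [Finset.mul_sum, ← Finset.sum_add_distrib]
    exact Finset.sum_congr rfl fun l _ => by ring
  · simp only [h, if_false]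
    simp [grad_zero, wedge_zero_right, c0_wedge_grad_X, grad]

theorem bracket_d_mem_evenPart {y : E38} (hy : y ∈ oddPart) (i : Fin 3) (a : Fin 2) :
    bracket y (d i a) ∈ evenPart := by
  obtain ⟨hy1, hy2, hy3⟩ := hy
  constructor
  · funext b
    change 0 + 0 + (act0 y.1 _ b - act0 (d i a).1 _ b) = 0
    simp [act0, hy1, hy2, app_zero_left, dv_zero, show vec (d i a).1 = 0 from rfl,
      show mat (d i a).1 = 0 from rfl]
  · funext b
    change 0 + 0 + (act2 y.1 _ _ b - act2 (d i a).1 _ _ b) = 0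
    simp [act2, hy1, hy2, hy3, dv_zero, lieForm_zero_left, grad_zero, wedge_zero_left,
      show vec (d i a).1 = 0 from rfl, show mat (d i a).1 = 0 from rfl,
      show frm (d i a).1 = 0 from rfl]

theorem vec_bracket_d {y : E38} (hy : y ∈ oddPart) (i : Fin 3) (a : Fin 2) (k : Fin 3) :
    vec (bracket y (d i a)).1 k = - ∑ b,
      (area b a • wedge (grad (odd0 y.1 b)) (grad (MvPowerSeries.X i)) k +
        area a b • (MvPowerSeries.X i * odd2 y.1 b k)) := by
  obtain ⟨hy1, hy2, hy3⟩ := hy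
  change vb (vec y.1) _ k + - (∑ a', ∑ b', area a' b' • _ : Triple) k + 0 = _
  have h1 : ∀ b c, wedge (grad (odd0 y.1 c)) (grad (odd0 (d i a).1 b)) =
      if b = a then wedge (grad (odd0 y.1 c)) (grad (MvPowerSeries.X i)) else 0 := by
    intro b c
    rw [odd0_d]
    split_ifs <;> simp [grad_zero, wedge_zero_right]
  rw [hy1, vb_zero_left]
  simp only [h1, odd2_d, smul_zero, add_zero]
  simp only [odd0_d]
  obtain rfl | rfl : a = 0 ∨ a = 1 := by omega
  · simp [Fin.sum_univ_two, area]
    ring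
  · simp [Fin.sum_univ_two, area]

theorem mat_bracket_d {y : E38} (hy : y ∈ oddPart) (i : Fin 3) (a e c : Fin 2) :
    mat (bracket y (d i a)).1 e c = - ∑ b, symSq a b e c •
      (odd2 y.1 b i - MvPowerSeries.X i * dv (odd2 y.1 b)) := by
  obtain ⟨hy1, hy2, hy3⟩ := hy
  change (mat y.1 * mat (d i a).1 - mat (d i a).1 * mat y.1 +
    (mat (d i a).1).map (app (vec y.1)) - (mat y.1).map (app (vec (d i a).1)) :
      Matrix (Fin 2) (Fin 2) R) e c +
    - (∑ a', ∑ b', (symSq a' b').map _ : Matrix (Fin 2) (Fin 2) R) e c + 0 = _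
  have h1 : ∀ b b', app (odd2 y.1 b') (odd0 (d i a).1 b) = if b = a then odd2 y.1 b' i else 0 := by
    intro b b'
    rw [odd0_d]
    split_ifs <;> simp [app, pd_X]
  simp only [h1, odd2_d, add_zero]
  simp only [odd0_d]
  rw [hy1, hy2, show vec (d i a).1 = 0 from rfl, show mat (d i a).1 = 0 from rfl]
  simp only [app_zero_left, dv_zero]
  obtain rfl | rfl : a = 0 ∨ a = 1 := by omega
  all_goals simp [Fin.sum_univ_two, Matrix.sum_apply, app_zero_left]

/-- The degree zero component of `[y, dᵢ^a]` for odd `y` whose `Ω⁰`-part has the second derivatives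
`q b l m` and whose `Ω²`-part has the constant terms `w b k`. -/
def oddDeg (q : Fin 2 → Fin 3 → Fin 3 → ℂ) (w : Fin 2 → Fin 3 → ℂ) (i : Fin 3) (a : Fin 2) : g0 :=
  (Matrix.of fun l k => - ∑ b, (area b a * ∑ m, levi k m i * q b l m +
      area a b * if i = l then w b k else 0),
   ⟨- ∑ b, w b i • symSq a b, by
      change Matrix.trace (_ : Matrix (Fin 2) (Fin 2) ℂ) = 0
      obtain rfl | rfl : a = 0 ∨ a = 1 := by omega
      all_goals simp [Matrix.trace_fin_two, Fin.sum_univ_two, symSq, area]⟩)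

/-- Second derivatives at the origin of the `Ω⁰`-part. -/
def hess (y : E38) (b : Fin 2) (l m : Fin 3) : ℂ := c0 (pd l (pd m (odd0 y.1 b)))

theorem hess_symm (y : E38) (b : Fin 2) (l m : Fin 3) : hess y b l m = hess y b m l := by
  rw [hess, pd_comm, hess]

/-- Constant terms of the `Ω²`-part. -/
def cst (y : E38) (b : Fin 2) (k : Fin 3) : ℂ := c0 (odd2 y.1 b k)

theorem degZero_bracket_d {y : E38} (hy : y ∈ oddPart) (i : Fin 3) (a : Fin 2) :
    degZero (bracket y (d i a)) = oddDeg (hess y) (cst y) i a := by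
  refine g0_ext (fun l k => ?_) (fun e c => ?_)
  · rw [degZero_fst, vec_bracket_d hy]
    change _ = - (∑ b : Fin 2, (_ + _) : ℂ)
    rw [map_neg, map_neg, map_sum, map_sum]
    congr 1
    refine Finset.sum_congr rfl fun b _ => ?_
    rw [map_add, Derivation.map_smul, map_add, c0_smul, c0_pd_wedge_grad_X, Derivation.map_smul,
      c0_smul]
    congr 2
    by_cases h : i = l <;> simp [pd_X, c0_X, cst, h]
  · rw [degZero_snd, mat_bracket_d hy]
    change _ = (- ∑ b, cst y b i • symSq a b) e c
    simp [Fin.sum_univ_two, c0_X, cst, mul_comm]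

/-! ### Action on the lowest components of an induced module -/

section Action

variable {W : Type} [AddCommGroup W] [Module ℂ W] [LieRingModule g0 W]

theorem U_smul_smul (u : U) (c : ℂ) (m : M W) : u • c • m = c • u • m :=
  smul_comm u c m

/-- The part in `g₋₁` of an odd element whose `Ω⁰`-part vanishes at the origin. -/
def linPart (y : E38) : E38 := ∑ j, ∑ b, c0 (pd j (odd0 y.1 b)) • d j b

theorem odd0_linPart (y : E38) (b : Fin 2) :
    odd0 (linPart y).1 b = ∑ j, c0 (pd j (odd0 y.1 b)) • MvPowerSeries.X j := by
  have : odd0 (linPart y).1 b =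
      ∑ j, ∑ b', c0 (pd j (odd0 y.1 b')) • odd0 (d j b').1 b := by
    simp [linPart, odd0, Fin.sum_univ_three]
  rw [this]
  simp [odd0_d]

theorem linPart_mem (y : E38) : linPart y ∈ oddPart := by
  refine ⟨?_, ?_, ?_⟩ <;> simp [linPart, d, vec, mat, frm, Fin.sum_univ_three]

theorem sub_linPart_mem {y : E38} (hy : y ∈ oddPart) : y - linPart y ∈ oddPart := by
  obtain ⟨h1, h2, h3⟩ := hy
  obtain ⟨k1, k2, k3⟩ := linPart_mem y
  refine ⟨?_, ?_, ?_⟩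
  · change vec y.1 - vec (linPart y).1 = 0
    rw [h1, k1, sub_zero]
  · change mat y.1 - mat (linPart y).1 = 0
    rw [h2, k2, sub_zero]
  · change frm y.1 - frm (linPart y).1 = 0
    rw [h3, k3, sub_zero]

/-- Splits an odd element of degree at least `-1` into its part in `g₋₁` and a remainder in `L₊`,
which kills `1 ⊗ w`. -/
theorem sub_linPart_mem_L0 {y : E38} (hy : y ∈ oddPart) (h0 : ∀ b, c0 (odd0 y.1 b) = 0) :
    y - linPart y ∈ L0 := by
  rw [mem_L0_iff]
  refine ⟨fun i => ?_, fun b => ?_, fun b i => ?_⟩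
  · rw [(sub_linPart_mem hy).1]; exact map_zero c0
  · change c0 (odd0 y.1 b - odd0 (linPart y).1 b) = 0
    rw [map_sub, h0, odd0_linPart, map_sum]
    simp [c0_X]
  · change c0 (pd i (odd0 y.1 b - odd0 (linPart y).1 b)) = 0
    rw [map_sub, map_sub, odd0_linPart, map_sum, map_sum]
    simp [pd_X, apply_ite c0]

theorem hess_sub_linPart (y : E38) : hess (y - linPart y) = hess y := by
  funext b l m
  change c0 (pd l (pd m (odd0 y.1 b - odd0 (linPart y).1 b))) = _
  rw [map_sub, map_sub, map_sub, odd0_linPart]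
  have : pd l (pd m (∑ j, c0 (pd j (odd0 y.1 b)) • (MvPowerSeries.X j : R))) = 0 := by
    simp [pd_X]
  rw [this, map_zero, sub_zero, hess]

theorem cst_sub_linPart (y : E38) : cst (y - linPart y) = cst y := by
  funext b k
  have h : odd2 (linPart y).1 b k = 0 := by
    simp [linPart, d, odd2, Fin.sum_univ_three]
  change c0 (odd2 y.1 b k - odd2 (linPart y).1 b k) = _
  rw [h, sub_zero, cst]

theorem ι_linPart_smul (y : E38) (m : M W) :
    ι (linPart y) • m = ∑ j, ∑ b, c0 (pd j (odd0 y.1 b)) • ι (d j b) • m := by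
  simp only [linPart, map_sum, map_smul, Finset.sum_smul, smul_assoc]

theorem ι_odd_smul_gen {y : E38} (hy : y ∈ oddPart) (h0 : ∀ b, c0 (odd0 y.1 b) = 0) (w : W) :
    ι y • gen w = ∑ j, ∑ b, c0 (pd j (odd0 y.1 b)) • ι (d j b) • gen w := by
  rw [← ι_linPart_smul, ← sub_eq_zero, ← sub_smul, ← map_sub,
    ι_smul_gen (sub_linPart_mem_L0 hy h0), degZero_odd (sub_linPart_mem hy), zero_lie, map_zero]

/-- An odd element of `L₀` has degree at least one, and `dᵢ^a` has degree `-1`. -/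
theorem bracket_d_mem_L0 {y : E38} (hy : y ∈ oddPart) (h0 : y ∈ L0) (i : Fin 3) (a : Fin 2) :
    bracket y (d i a) ∈ L0 := by
  have he := bracket_d_mem_evenPart hy i a
  rw [mem_L0_iff] at h0 ⊢
  refine ⟨fun k => ?_, fun b => ?_, fun b k => ?_⟩
  · rw [vec_bracket_d hy, map_neg, map_sum, Finset.sum_eq_zero, neg_zero]
    intro b _
    rw [map_add, c0_smul, c0_smul, c0_wedge_grad_X, map_mul, c0_X]
    simp [grad, h0.2.2]
  · rw [he.1]; exact map_zero c0
  · rw [he.1]; change c0 (pd k 0) = 0; simp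

/-- Since `y` kills `1 ⊗ w`, only the bracket remains; it lies in `L₀` and acts through its degree
zero component. -/
theorem ι_odd_smul_d {y : E38} (hy : y ∈ oddPart) (h0 : y ∈ L0) (i : Fin 3) (a : Fin 2) (w : W) :
    ι y • ι (d i a) • gen w = gen ⁅oddDeg (hess y) (cst y) i a, w⁆ := by
  rw [smul_smul, ι_odd_mul hy (d_mem i a), sub_smul, mul_smul, ι_smul_gen h0, degZero_odd hy,
    zero_lie, map_zero, smul_zero, sub_zero, ι_smul_gen (bracket_d_mem_L0 hy h0 i a),
    degZero_bracket_d hy]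

theorem ι_odd_smul_d' {y : E38} (hy : y ∈ oddPart) (h0 : ∀ b, c0 (odd0 y.1 b) = 0)
    (i : Fin 3) (a : Fin 2) (w : W) :
    ι y • ι (d i a) • gen w = gen ⁅oddDeg (hess y) (cst y) i a, w⁆ +
      ∑ j, ∑ b, c0 (pd j (odd0 y.1 b)) • ι (d j b) • ι (d i a) • gen w := by
  rw [← ι_linPart_smul, ← sub_eq_iff_eq_add, ← sub_smul, ← map_sub,
    ι_odd_smul_d (sub_linPart_mem hy) (sub_linPart_mem_L0 hy h0), hess_sub_linPart,
    cst_sub_linPart]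

theorem c0_odd0_bracket_d {x : E38} (hx : x ∈ evenPart) (h0 : x ∈ L0) (i : Fin 3) (a b : Fin 2) :
    c0 (odd0 (bracket x (d i a)).1 b) = 0 := by
  rw [mem_L0_iff] at h0
  rw [odd0_bracket_d hx]
  split_ifs <;> simp [c0_X, h0.1 i]

/-- Justifies `coefD`: the term `-½ div` of the bracket `[D, f ⊗ v]` is the source of the half
trace. -/
theorem c0_pd_odd0_bracket_d {x : E38} (hx : x ∈ evenPart) (i : Fin 3)
    (a : Fin 2) (j : Fin 3) (b : Fin 2) :
    c0 (pd j (odd0 (bracket x (d i a)).1 b)) = coefD (degZero x) j b i a := by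
  have ht : (degZero x).1.trace = c0 (dv (vec x.1)) := by
    simp [Matrix.trace, degZero_fst, dv]
  rw [odd0_bracket_d hx, coefD, ht, degZero_fst, degZero_snd]
  by_cases h : j = i
  · subst h
    by_cases hb : b = a
    · simp [c0_X, pd_X, hb]
      ring
    · simp [c0_X, pd_X, hb]
  · by_cases hb : b = a <;> simp [c0_X, pd_X, h, Ne.symm h, hb]

theorem ι_even_smul_d {x : E38} (hx : x ∈ evenPart) (h0 : x ∈ L0) (i : Fin 3) (a : Fin 2)
    (w : W) :
    ι x • ι (d i a) • gen w = ι (d i a) • gen ⁅degZero x, w⁆ +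
      ∑ j, ∑ b, coefD (degZero x) j b i a • ι (d j b) • gen w := by
  rw [smul_smul, ι_even_mul hx, add_smul, mul_smul, ι_smul_gen h0,
    ι_odd_smul_gen (bracket_mem_oddPart hx (d_mem i a)) (c0_odd0_bracket_d hx h0 i a)]
  simp only [c0_pd_odd0_bracket_d hx]

/-- The last term is the double commutator `[[x, dᵢ^a], d_j^b]`, seen only by the degree two part of
`x`. The two sums come from the part of a single commutator in `g₋₁`. -/
theorem ι_even_smul_d_d {x : E38} (hx : x ∈ evenPart) (h0 : x ∈ L0) (i j : Fin 3) (a b : Fin 2)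
    (w : W) :
    ι x • ι (d i a) • ι (d j b) • gen w = ι (d i a) • ι (d j b) • gen ⁅degZero x, w⁆ +
      (∑ k, ∑ c, coefD (degZero x) k c j b • ι (d i a) • ι (d k c) • gen w) +
      (∑ k, ∑ c, coefD (degZero x) k c i a • ι (d k c) • ι (d j b) • gen w) +
      gen ⁅oddDeg (hess (bracket x (d i a))) (cst (bracket x (d i a))) j b, w⁆ := by
  rw [smul_smul, ι_even_mul hx, add_smul, mul_smul, ι_even_smul_d hx h0,
    ι_odd_smul_d' (bracket_mem_oddPart hx (d_mem i a)) (c0_odd0_bracket_d hx h0 i a)]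
  simp only [c0_pd_odd0_bracket_d hx, smul_add, Finset.smul_sum, U_smul_smul]
  abel

/-- Here `[x, dᵢ^a]` is an even element of `L₀`: it acts on `w` and also rotates `d_j^b`. The minus
sign comes from moving the odd `x` past the odd `dᵢ^a`. -/
theorem ι_odd_smul_d_d {x : E38} (hx : x ∈ oddPart) (h0 : x ∈ L0) (i j : Fin 3) (a b : Fin 2)
    (w : W) :
    ι x • ι (d i a) • ι (d j b) • gen w =
      ι (d j b) • gen ⁅oddDeg (hess x) (cst x) i a, w⁆ +
      (∑ k, ∑ c, coefD (oddDeg (hess x) (cst x) i a) k c j b • ι (d k c) • gen w) -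
      ι (d i a) • gen ⁅oddDeg (hess x) (cst x) j b, w⁆ := by
  rw [smul_smul, ι_odd_mul hx (d_mem i a), sub_smul, mul_smul, ι_odd_smul_d hx h0,
    ι_even_smul_d (bracket_d_mem_evenPart hx i a) (bracket_d_mem_L0 hx h0 i a),
    degZero_bracket_d hx]

end Action

/-! ### Anticommutation of the operators `Δ^±` -/

theorem bracket_d_d (i j : Fin 3) (a b : Fin 2) :
    (bracket (d i a) (d j b)).1 =
      (- area a b • wedge (grad (MvPowerSeries.X i)) (grad (MvPowerSeries.X j)), 0, 0, 0, 0) := by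
  have he := bracket_d_mem_evenPart (d_mem i a) j b
  refine Prod.ext ?_ (Prod.ext ?_ (Prod.ext ?_ (Prod.ext he.1 he.2)))
  · funext k
    refine (vec_bracket_d (d_mem i a) j b k).trans ?_
    have h1 : ∀ c, wedge (grad (odd0 (d i a).1 c)) (grad (MvPowerSeries.X j)) =
        if c = a then wedge (grad (MvPowerSeries.X i)) (grad (MvPowerSeries.X j)) else 0 := by
      intro c
      rw [odd0_d]
      split_ifs <;> simp [grad_zero, wedge_zero_left]
    simp only [h1, odd2_d]
    obtain rfl | rfl : a = 0 ∨ a = 1 := by omega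
    all_goals obtain rfl | rfl : b = 0 ∨ b = 1 := by omega
    all_goals simp [area]
  · refine Matrix.ext fun e c => ?_
    refine (mat_bracket_d (d_mem i a) j b e c).trans ?_
    simp [odd2_d, dv_zero]
  · change (evenBr (d i a).1 (d j b).1).2.2.1 + (oddBr (d i a).1 (d j b).1).2.2.1 + 0 = 0
    simp only [evenBr, oddBr, odd2_d, show vec (d i a).1 = 0 from rfl,
      show mat (d i a).1 = 0 from rfl, show frm (d i a).1 = 0 from rfl,
      show vec (d j b).1 = 0 from rfl, show mat (d j b).1 = 0 from rfl,
      show frm (d j b).1 = 0 from rfl, dv_zero, grad_zero, wedge_zero_left, curl_zero,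
      lieForm_zero_left, Matrix.zero_apply]
    simp

theorem bracket_d_d_swap (i j : Fin 3) (a b : Fin 2) :
    bracket (d i a) (d j b) = - bracket (d j a) (d i b) := by
  have h : ∀ α β : Triple, wedge α β = - wedge β α := by
    intro α β
    funext k
    fin_cases k <;> simp [wedge] <;> ring
  refine Subtype.ext ?_
  change _ = - (bracket (d j a) (d i b)).1
  rw [bracket_d_d, bracket_d_d, h (grad (MvPowerSeries.X i))]
  simp

/-- The algebra `U` contains `ℂ`, so `2` is invertible on every `U`-module. -/
theorem eq_zero_of_eq_neg {N : Type} [AddCommGroup N] [Module U N] {x : N} (h : x = - x) :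
    x = 0 := by
  have hs : (1 : U) = algebraMap ℂ U (1 / 2) + algebraMap ℂ U (1 / 2) := by
    rw [← map_add, add_halves, map_one]
  rw [← one_smul U x, hs, add_smul]
  nth_rewrite 2 [h]
  rw [smul_neg, add_neg_cancel]

/-- The operators `Δ^a = ∑ dᵢ^a ⊗ ∂ᵢ` anticommute: in `∑ dᵢ^a d_j^b ⊗ ∂ᵢ∂_j`, the indices `a`, `b`
can be exchanged up to a sign. -/
theorem sum_ι_d_d_anticomm {N : Type} [AddCommGroup N] [Module U N] (a b : Fin 2)
    (T : Fin 3 → Fin 3 → N) (hT : ∀ i j, T i j = T j i) :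
    ∑ i, ∑ j, ι (d i a) • ι (d j b) • T i j = - ∑ i, ∑ j, ι (d i b) • ι (d j a) • T i j := by
  have h1 : ∀ i j, ι (d i a) • ι (d j b) • T i j =
      ι (bracket (d i a) (d j b)) • T i j - ι (d j b) • ι (d i a) • T i j := by
    intro i j
    rw [smul_smul, ι_odd_mul (d_mem i a) (d_mem j b), sub_smul, mul_smul]
  -- The bracket is antisymmetric and `T` symmetric in `i, j`, so exchanging the indices changes the
  -- sign of the sum.
  have h2 : ∑ i, ∑ j, ι (bracket (d i a) (d j b)) • T i j = 0 := by
    have : ∑ i, ∑ j, ι (bracket (d i a) (d j b)) • T i j =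
        - ∑ i, ∑ j, ι (bracket (d i a) (d j b)) • T i j := by
      conv_lhs => rw [Finset.sum_comm]
      rw [← Finset.sum_neg_distrib]
      refine Finset.sum_congr rfl fun j _ => ?_
      rw [← Finset.sum_neg_distrib]
      refine Finset.sum_congr rfl fun i _ => ?_
      rw [bracket_d_d_swap, map_neg, neg_smul, hT]
    exact eq_zero_of_eq_neg this
  simp only [h1, Finset.sum_sub_distrib, h2, zero_sub]
  rw [Finset.sum_comm]
  simp only [hT]

theorem sum_ι_d_d_self {N : Type} [AddCommGroup N] [Module U N] (a : Fin 2)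
    (T : Fin 3 → Fin 3 → N) (hT : ∀ i j, T i j = T j i) :
    ∑ i, ∑ j, ι (d i a) • ι (d j a) • T i j = 0 :=
  eq_zero_of_eq_neg (sum_ι_d_d_anticomm a a T hT)

theorem sum_sum_comm {N α β : Type} [AddCommMonoid N] [Fintype α] [Fintype β]
    (f : α → β → α → β → N) :
    ∑ i, ∑ a, ∑ j, ∑ b, f i a j b = ∑ j, ∑ b, ∑ i, ∑ a, f i a j b := by
  calc _ = ∑ i, ∑ j, ∑ a, ∑ b, f i a j b := Finset.sum_congr rfl fun i _ => Finset.sum_comm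
    _ = ∑ j, ∑ i, ∑ b, ∑ a, f i a j b := by
      rw [Finset.sum_comm]
      exact Finset.sum_congr rfl fun j _ => Finset.sum_congr rfl fun i _ => Finset.sum_comm
    _ = _ := Finset.sum_congr rfl fun j _ => Finset.sum_comm

theorem sum_rotate {N α : Type} [AddCommMonoid N] [Fintype α] (f : α → α → α → N) :
    ∑ i, ∑ j, ∑ k, f i j k = ∑ k, ∑ i, ∑ j, f i j k := by
  rw [Finset.sum_comm (s := Finset.univ) (t := Finset.univ) (f := fun k i => ∑ j, f i j k)]
  exact Finset.sum_congr rfl fun i _ => Finset.sum_comm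

/-- Separates the `gl₃`-part, the diagonal weight and the off-diagonal `sl₂`-entry. The entry turns
`dᵢ⁻ d_j⁺` into `dᵢ⁻ d_j⁻`, whose contribution vanishes after symmetrisation. -/
theorem sum_coefD_zero {N : Type} [AddCommGroup N] [Module ℂ N] (p : g0)
    (f : Fin 3 → Fin 3 → Fin 3 → Fin 2 → N) :
    ∑ i, ∑ j, ∑ k, ∑ c, coefD p k c j 0 • f i j k c =
      ∑ i, ∑ j, ∑ k, p.1 k j • f i j k 0 +
        (p.2.1 0 0 - p.1.trace / 2) • ∑ i, ∑ j, f i j j 0 + p.2.1 1 0 • ∑ i, ∑ j, f i j j 1 := by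
  simp only [Finset.smul_sum, ← Finset.sum_add_distrib]
  refine Finset.sum_congr rfl fun i _ => Finset.sum_congr rfl fun j _ => ?_
  simp [coefD, add_smul, ite_smul, sub_smul, Finset.sum_add_distrib]
  abel

theorem sum_coefD_one {N : Type} [AddCommGroup N] [Module ℂ N] (p : g0)
    (f : Fin 3 → Fin 3 → Fin 3 → Fin 2 → N) :
    ∑ i, ∑ j, ∑ k, ∑ c, coefD p k c i 1 • f i j k c =
      ∑ i, ∑ j, ∑ k, p.1 k i • f i j k 1 -
        (p.2.1 0 0 + p.1.trace / 2) • ∑ i, ∑ j, f i j i 1 + p.2.1 0 1 • ∑ i, ∑ j, f i j i 0 := by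
  have hp : p.2.1 1 1 = - p.2.1 0 0 := by
    have h : p.2.1.trace = 0 := p.2.2
    rw [Matrix.trace_fin_two] at h
    exact eq_neg_of_add_eq_zero_right h
  simp only [Finset.smul_sum, ← Finset.sum_add_distrib, ← Finset.sum_sub_distrib]
  refine Finset.sum_congr rfl fun i _ => Finset.sum_congr rfl fun j _ => ?_
  simp [coefD, add_smul, ite_smul, sub_smul, Finset.sum_add_distrib, hp]
  abel

/-! ### Criteria for morphisms of degree one and two in the `d`'s -/

section Singular

variable {V W : Type} [AddCommGroup V] [Module ℂ V] [LieRingModule g0 V]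
  [AddCommGroup W] [Module ℂ W] [LieRingModule g0 W]

/-- A criterion for `v ↦ ∑ dᵢ^a ⊗ P i a v` to define a morphism of induced modules. -/
theorem exists_hom_of_degree_one (P : Fin 3 → Fin 2 → V →ₗ[ℂ] W)
    (hE : ∀ p j b v, P j b ⁅p, v⁆ = ⁅p, P j b v⁆ + ∑ i, ∑ a, coefD p j b i a • P i a v)
    (hS : ∀ q w v, (∀ b l m, q b l m = q b m l) →
      ∑ i, ∑ a, ⁅oddDeg q w i a, P i a v⁆ = 0) :
    ∃ φ : M V →ₗ[U] M W, ∀ v, φ (gen v) = ∑ i, ∑ a, ι (d i a) • gen (P i a v) := by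
  let F : V →ₗ[ℂ] M W := ∑ i, ∑ a, (Module.toModuleEnd ℂ (S := U) (M W) (ι (d i a))).comp
    (gen.comp (P i a))
  have hF : ∀ v, F v = ∑ i, ∑ a, ι (d i a) • gen (P i a v) := by
    intro v
    simp [F]
  suffices h : ∀ x ∈ L0, ∀ v, ι x • F v = F ⁅degZero x, v⁆ by
    obtain ⟨φ, hφ⟩ := exists_hom F h
    exact ⟨φ, fun v => by rw [hφ, hF]⟩
  intro x hx v
  -- The terms in which `x` is commuted with `dᵢ^a` are exactly the `coefD`-terms of `hE`, once the
  -- two pairs of indices are exchanged.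
  have he : ι (evenComp x) • F v = F ⁅degZero x, v⁆ := by
    simp only [hF]
    simp only [Finset.smul_sum]
    simp only [ι_even_smul_d (evenComp_mem x) (evenComp_mem_L0 hx)]
    simp only [degZero_evenComp, hE]
    simp only [map_add]
    simp only [map_sum, map_smul]
    simp only [smul_add, Finset.sum_add_distrib, Finset.smul_sum, U_smul_smul]
    rw [sum_sum_comm]
  have ho : ι (oddComp x) • F v = 0 := by
    simp only [hF, Finset.smul_sum, ι_odd_smul_d (oddComp_mem x) (oddComp_mem_L0 hx)]
    simp only [← map_sum]
    rw [hS _ _ _ (hess_symm _), map_zero]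
  conv_lhs => rw [← evenComp_add_oddComp x]
  rw [map_add, add_smul, he, ho, add_zero]

/-- A criterion for `v ↦ ∑ dᵢ⁻ d_j⁺ ⊗ Q i j v` to define a morphism of induced modules. -/
theorem exists_hom_of_degree_two (Q : Fin 3 → Fin 3 → V →ₗ[ℂ] W) (hQ : ∀ i j, Q i j = Q j i)
    (hE : ∀ (p : g0) k l v, Q k l ⁅p, v⁆ = ⁅p, Q k l v⁆ + ∑ i, p.1 k i • Q i l v +
      ∑ j, p.1 l j • Q k j v - p.1.trace • Q k l v)
    (hD : ∀ (D : Fin 3 → Fin 3 → Fin 3 → ℂ) (φ μ : Fin 3 → ℂ)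
      (q : Fin 3 → Fin 2 → Fin 3 → Fin 3 → ℂ) (w : Fin 3 → Fin 2 → Fin 3 → ℂ) (v : V),
      (∀ i l m, D i l m = D i m l) →
      (∀ i l m, q i 1 l m = D i l m + (if m = i then μ l else 0) + if l = i then μ m else 0) →
      (∀ i k, w i 1 k = ∑ l, levi k l i * φ l) →
      ∑ i, ∑ j, ⁅oddDeg (q i) (w i) j 0, Q i j v⁆ = 0)
    (hS : ∀ q w v k, (∀ b l m, q b l m = q b m l) →
      ∑ i, ∑ j, coefD (oddDeg q w i 1) k 1 j 0 • Q i j v - ∑ j, ⁅oddDeg q w j 0, Q k j v⁆ = 0)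
    (hS' : ∀ q w v k, (∀ b l m, q b l m = q b m l) →
      ∑ i, ∑ j, coefD (oddDeg q w i 1) k 0 j 0 • Q i j v + ∑ i, ⁅oddDeg q w i 1, Q i k v⁆ = 0) :
    ∃ φ : M V →ₗ[U] M W, ∀ v, φ (gen v) =
      ∑ i, ∑ j, ι (d i 1) • ι (d j 0) • gen (Q i j v) := by
  let F : V →ₗ[ℂ] M W := ∑ i, ∑ j, (Module.toModuleEnd ℂ (S := U) (M W) (ι (d i 1))).comp
    ((Module.toModuleEnd ℂ (S := U) (M W) (ι (d j 0))).comp (gen.comp (Q i j)))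
  have hF : ∀ v, F v = ∑ i, ∑ j, ι (d i 1) • ι (d j 0) • gen (Q i j v) := by
    intro v
    simp [F]
  suffices h : ∀ x ∈ L0, ∀ v, ι x • F v = F ⁅degZero x, v⁆ by
    obtain ⟨φ, hφ⟩ := exists_hom F h
    exact ⟨φ, fun v => by rw [hφ, hF]⟩
  intro x hx v
  have he : ι (evenComp x) • F v = F ⁅degZero x, v⁆ := by
    -- The double commutators, which involve second order Taylor coefficients of the vector field
    -- and first order ones of the matrix.
    have h1 : ∑ i, ∑ j, gen ⁅oddDeg (hess (bracket (evenComp x) (d i 1)))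
        (cst (bracket (evenComp x) (d i 1))) j 0, Q i j v⁆ = 0 := by
      simp only [← map_sum]
      -- By `odd0_bracket_d` the `ε⁻`-coefficient of `[x, dᵢ⁻]` is `Pᵢ - ½ (div P) xᵢ + g₋₋ xᵢ`. Its
      -- Hessian is that of `Pᵢ`, called `D`, plus the terms with `μ`, the gradient of `-½ div P +
      -- g₋₋`. By `odd2_bracket_d`, `φ` is the gradient of `½ div P + g₋₋`.
      rw [hD (fun i l m => c0 (pd l (pd m (vec x.1 i))))
        (fun l => c0 (pd l (dv (vec x.1))) / 2 + c0 (pd l (mat x.1 1 1)))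
        (fun l => - c0 (pd l (dv (vec x.1))) / 2 + c0 (pd l (mat x.1 1 1))), map_zero]
      · intro i l m
        exact congrArg c0 (pd_comm l m _)
      · intro i l m
        rw [hess, odd0_bracket_d (evenComp_mem x), if_pos rfl]
        simp only [map_add, map_sub, Derivation.map_smul, c0_smul, c0_pd_pd_mul_X]
        split_ifs
        all_goals simp only [evenComp]; ring
      · intro i k
        rw [cst, odd2_bracket_d (evenComp_mem x)]
        rfl
    -- Symmetry of `Q` makes `(Δ^c)² = 0`, which removes the off-diagonal entries of `sl₂` in `h3`
    -- and `h4`. Their diagonal weights `g₊₊ - ½ tr` and `-(g₊₊ + ½ tr)` add up to the `-tr` of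
    -- `hE`.
    have h2 : ∀ c : Fin 2, ∑ i, ∑ j, ι (d i c) • ι (d j c) • gen (Q i j v) = 0 := by
      intro c
      exact sum_ι_d_d_self c (fun i j => gen (Q i j v)) fun i j => by rw [hQ]
    obtain ⟨p, hpx⟩ : ∃ p, degZero x = p := ⟨_, rfl⟩
    have h3 : ∑ i, ∑ j, ∑ k, ∑ c, coefD p k c j 0 • ι (d i 1) • ι (d k c) • gen (Q i j v) =
        ∑ i, ∑ j, ∑ k, p.1 k j • ι (d i 1) • ι (d k 0) • gen (Q i j v) +
        (p.2.1 0 0 - p.1.trace / 2) • ∑ i, ∑ j, ι (d i 1) • ι (d j 0) • gen (Q i j v) := by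
      rw [sum_coefD_zero (N := M W) p fun i j k c => ι (d i 1) • ι (d k c) • gen (Q i j v), h2,
        smul_zero, add_zero]
    have h4 : ∑ i, ∑ j, ∑ k, ∑ c, coefD p k c i 1 • ι (d k c) • ι (d j 0) • gen (Q i j v) =
        ∑ i, ∑ j, ∑ k, p.1 k i • ι (d k 1) • ι (d j 0) • gen (Q i j v) -
        (p.2.1 0 0 + p.1.trace / 2) • ∑ i, ∑ j, ι (d i 1) • ι (d j 0) • gen (Q i j v) := by
      rw [sum_coefD_one (N := M W) p fun i j k c => ι (d k c) • ι (d j 0) • gen (Q i j v), h2,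
        smul_zero, add_zero]
    simp only [hF]
    simp only [Finset.smul_sum]
    simp only [ι_even_smul_d_d (evenComp_mem x) (evenComp_mem_L0 hx)]
    simp only [degZero_evenComp, Finset.sum_add_distrib, h1, add_zero]
    simp only [hpx, h3, h4, hE]
    simp only [map_sub, map_add]
    simp only [map_sum, map_smul]
    simp only [smul_add, smul_sub, Finset.smul_sum, U_smul_smul, Finset.sum_add_distrib,
      Finset.sum_sub_distrib]
    have h5 : ∑ i, ∑ j, ∑ k, p.1 k j • ι (d i 1) • ι (d k 0) • gen (Q i j v) =
        ∑ i, ∑ k, ∑ j, p.1 k j • ι (d i 1) • ι (d k 0) • gen (Q i j v) :=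
      Finset.sum_congr rfl fun i _ => Finset.sum_comm
    have h6 : ∑ i, ∑ j, ∑ k, p.1 k i • ι (d k 1) • ι (d j 0) • gen (Q i j v) =
        ∑ k, ∑ j, ∑ i, p.1 k i • ι (d k 1) • ι (d j 0) • gen (Q i j v) := by
      rw [Finset.sum_comm]
      conv_rhs => rw [Finset.sum_comm]
      exact Finset.sum_congr rfl fun j _ => Finset.sum_comm
    simp only [h5, h6, ← Finset.smul_sum]
    module
  have ho : ι (oddComp x) • F v = 0 := by
    simp only [hF, Finset.smul_sum, ι_odd_smul_d_d (oddComp_mem x) (oddComp_mem_L0 hx)]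
    set q := hess (oddComp x)
    set w := cst (oddComp x)
    have e1 : ∀ k, ι (d k 1) • gen (∑ i, ∑ j, coefD (oddDeg q w i 1) k 1 j 0 • Q i j v -
        ∑ j, ⁅oddDeg q w j 0, Q k j v⁆) = 0 := by
      intro k
      rw [hS q w v k (hess_symm _), map_zero, smul_zero]
    have e0 : ∀ k, ι (d k 0) • gen (∑ i, ∑ j, coefD (oddDeg q w i 1) k 0 j 0 • Q i j v +
        ∑ i, ⁅oddDeg q w i 1, Q i k v⁆) = 0 := by
      intro k
      rw [hS' q w v k (hess_symm _), map_zero, smul_zero]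
    -- Sorting the result by `d_k⁻` and `d_k⁺`: the coefficient of each is one of the expressions in
    -- `hS` and `hS'`.
    have e2 : ∑ k, (ι (d k 1) • gen (∑ i, ∑ j, coefD (oddDeg q w i 1) k 1 j 0 • Q i j v -
        ∑ j, ⁅oddDeg q w j 0, Q k j v⁆) +
        ι (d k 0) • gen (∑ i, ∑ j, coefD (oddDeg q w i 1) k 0 j 0 • Q i j v +
        ∑ i, ⁅oddDeg q w i 1, Q i k v⁆)) = 0 := by
      simp only [e1, e0, add_zero, Finset.sum_const_zero]
    rw [← e2]
    simp only [map_sub, map_add]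
    simp only [map_sum, map_smul]
    simp only [smul_add, smul_sub, Finset.smul_sum, U_smul_smul, Finset.sum_add_distrib,
      Finset.sum_sub_distrib, Fin.sum_univ_two]
    rw [sum_rotate fun i j k => coefD (oddDeg q w i 1) k 0 j 0 • ι (d k 0) • gen (Q i j v),
      sum_rotate fun i j k => coefD (oddDeg q w i 1) k 1 j 0 • ι (d k 1) • gen (Q i j v),
      Finset.sum_comm (f := fun i j => ι (d j 0) • gen ⁅oddDeg q w i 1, Q i j v⁆)]
    abel
  conv_lhs => rw [← evenComp_add_oddComp x]
  rw [map_add, add_smul, he, ho, add_zero]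

end Singular

/-! ### Cancellations in the degree zero components -/

/-- The Hessian drops out, being symmetric and contracted with the antisymmetric symbol. -/
theorem trace_oddDeg {q : Fin 2 → Fin 3 → Fin 3 → ℂ} {w : Fin 2 → Fin 3 → ℂ}
    (hq : ∀ b l m, q b l m = q b m l) (i : Fin 3) (a : Fin 2) :
    (oddDeg q w i a).1.trace = - ∑ b, area a b * w b i := by
  fin_cases i <;> simp [Matrix.trace, oddDeg, levi, Fin.sum_univ_three,
    hq _ 1 0, hq _ 2 0, hq _ 2 1] <;> ring

/-- The vanishing that makes `∇` singular, for the action of `gl₃ ⊕ sl₂` through differential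
operators: `T s t i a` stands for `x_s ∂_t ∂_i ∂_a f` and `Z c e i a` for `z_c ∂_e ∂_i ∂_a f`. -/
theorem sum_oddDeg_one {N : Type} [AddCommGroup N] [Module ℂ N]
    (T : Fin 3 → Fin 3 → Fin 3 → Fin 2 → N) (Z : Fin 2 → Fin 2 → Fin 3 → Fin 2 → N)
    (hT : ∀ s t i a, T s t i a = T s i t a) (hZ : ∀ c e i a, Z c e i a = Z c a i e)
    (q : Fin 2 → Fin 3 → Fin 3 → ℂ) (w : Fin 2 → Fin 3 → ℂ) (hq : ∀ b l m, q b l m = q b m l) :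
    ∑ i, ∑ a, (∑ s, ∑ t, (oddDeg q w i a).1 s t • T s t i a -
      (oddDeg q w i a).1.trace • ∑ m, T m m i a +
      ∑ c, ∑ e, (oddDeg q w i a).2.1 c e • Z c e i a +
      ((oddDeg q w i a).1.trace / 2) • ∑ c, Z c c i a) = 0 := by
  -- The `q`-terms vanish since `∂_t∂ᵢ` is symmetric. The `w`-part of the vector field, `x_i ∂_t
  -- ∂_i` with weight `w_t`, cancels the trace times the Euler operator. In the `sl₂`-part one half
  -- of `v · v'` dies by symmetry of `∂_e∂_a`, and the other cancels the half trace.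
  simp only [trace_oddDeg hq]
  simp only [oddDeg, Matrix.of_apply, Fin.sum_univ_three, Fin.sum_univ_two, levi, area]
  simp [symSq, area, hT _ 1 0, hT _ 2 0, hT _ 2 1, hZ _ 1 _ 0, hq _ 1 0, hq _ 2 0, hq _ 2 1]
  module

/-- The vanishing that makes `∇₂` invariant in degree two: `T s t i j` stands for
`x_s ∂_t ∂_i ∂_j f` and `Q i j` for `∂_i ∂_j f`. -/
theorem sum_oddDeg_two {N : Type} [AddCommGroup N] [Module ℂ N]
    (T : Fin 3 → Fin 3 → Fin 3 → Fin 3 → N) (Q : Fin 3 → Fin 3 → N)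
    (hT : ∀ s t i j, T s t i j = T s i t j) (hT' : ∀ s t i j, T s t i j = T s t j i)
    (hQ : ∀ i j, Q i j = Q j i)
    (D : Fin 3 → Fin 3 → Fin 3 → ℂ) (φ μ : Fin 3 → ℂ) (q : Fin 3 → Fin 2 → Fin 3 → Fin 3 → ℂ)
    (w : Fin 3 → Fin 2 → Fin 3 → ℂ) (hD : ∀ i l m, D i l m = D i m l)
    (hq : ∀ i l m, q i 1 l m = D i l m + (if m = i then μ l else 0) + if l = i then μ m else 0)
    (hw : ∀ i k, w i 1 k = ∑ l, levi k l i * φ l) :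
    ∑ i, ∑ j, (∑ s, ∑ t, (oddDeg (q i) (w i) j 0).1 s t • T s t i j -
      (oddDeg (q i) (w i) j 0).1.trace • (∑ m, T m m i j + Q i j)) = 0 := by
  have hq' : ∀ i l m, q i 1 l m = q i 1 m l := by
    intro i l m
    rw [hq, hq, hD, add_right_comm]
  have ht : ∀ i j, (oddDeg (q i) (w i) j 0).1.trace = - w i 1 j := by
    intro i j
    fin_cases j <;> simp [Matrix.trace, oddDeg, levi, Fin.sum_univ_three, area,
      hq' _ 1 0, hq' _ 2 0, hq' _ 2 1]
  -- The `q`-terms vanish as before. Each remaining term contracts `w i 1 k`, antisymmetric in `i,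
  -- k` by `hw`, with the symmetric `∂ᵢ∂_k`.
  simp only [ht]
  simp only [oddDeg, Matrix.of_apply, Fin.sum_univ_three, Fin.sum_univ_two, levi, area, hw]
  simp [hT _ 1 0, hT _ 2 0, hT _ 2 1, hT' _ _ 1 0, hT' _ _ 2 0, hT' _ _ 2 1,
     hQ 1 0, hQ 2 0, hQ 2 1, hq' _ 1 0, hq' _ 2 0, hq' _ 2 1]
  module

/-- The third order terms cancel as in `sum_oddDeg_one`. What is left is `∑ w₋ⱼ Q k j` twice with
opposite signs: once from the entry of `sl₂` sending `ε⁺` to `ε⁻`, once from the trace shift `Q k j`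
of the target module. -/
theorem sum_coefD_sub {N : Type} [AddCommGroup N] [Module ℂ N]
    (T : Fin 3 → Fin 3 → Fin 3 → Fin 3 → N) (Q : Fin 3 → Fin 3 → N)
    (hT : ∀ s t i j, T s t i j = T s i t j) (hT' : ∀ s t i j, T s t i j = T s t j i)
    (hQ : ∀ i j, Q i j = Q j i)
    (q : Fin 2 → Fin 3 → Fin 3 → ℂ) (w : Fin 2 → Fin 3 → ℂ) (hq : ∀ b l m, q b l m = q b m l)
    (k : Fin 3) :
    ∑ i, ∑ j, coefD (oddDeg q w i 1) k 1 j 0 • Q i j -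
      ∑ j, (∑ s, ∑ t, (oddDeg q w j 0).1 s t • T s t k j -
      (oddDeg q w j 0).1.trace • (∑ m, T m m k j + Q k j)) = 0 := by
  simp only [trace_oddDeg hq, coefD]
  simp only [oddDeg, Matrix.of_apply, Fin.sum_univ_three, Fin.sum_univ_two, levi, area]
  fin_cases k
  all_goals
    simp [symSq, area, hT _ 1 0, hT _ 2 0, hT _ 2 1, hT' _ _ 1 0, hT' _ _ 2 0, hT' _ _ 2 1,
     hQ 1 0, hQ 2 0, hQ 2 1, hq _ 1 0, hq _ 2 0, hq _ 2 1]
    module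

/-- In `coefD` the half trace and the diagonal entry of `sl₂` cancel, leaving the `gl₃`-matrix. Its
`q`-part vanishes against `Q i j`, and its `w`-part gives `∑ w₊ⱼ Q k j`, which the trace shift
compensates. -/
theorem sum_coefD_add {N : Type} [AddCommGroup N] [Module ℂ N]
    (T : Fin 3 → Fin 3 → Fin 3 → Fin 3 → N) (Q : Fin 3 → Fin 3 → N)
    (hT : ∀ s t i j, T s t i j = T s i t j) (hT' : ∀ s t i j, T s t i j = T s t j i)
    (hQ : ∀ i j, Q i j = Q j i)
    (q : Fin 2 → Fin 3 → Fin 3 → ℂ) (w : Fin 2 → Fin 3 → ℂ) (hq : ∀ b l m, q b l m = q b m l)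
    (k : Fin 3) :
    ∑ i, ∑ j, coefD (oddDeg q w i 1) k 0 j 0 • Q i j +
      ∑ i, (∑ s, ∑ t, (oddDeg q w i 1).1 s t • T s t i k -
      (oddDeg q w i 1).1.trace • (∑ m, T m m i k + Q i k)) = 0 := by
  simp only [trace_oddDeg hq, coefD]
  simp only [oddDeg, Matrix.of_apply, Fin.sum_univ_three, Fin.sum_univ_two, levi, area]
  fin_cases k
  all_goals
    simp [symSq, area, hT _ 1 0, hT _ 2 0, hT _ 2 1, hT' _ _ 1 0, hT' _ _ 2 0, hT' _ _ 2 1,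
     hQ 1 0, hQ 2 0, hQ 2 1, hq _ 1 0, hq _ 2 0, hq _ 2 1]
    module

-- The action of `g₀` by differential operators and the morphism `∇`

attribute [local instance] LieRing.ofAssociativeRing
attribute [local instance] LieAlgebra.ofAssociativeAlgebra

theorem delOp_comm (X : Quadrant) (s t : Idx) (f : Osc) :
    delOp X s (delOp X t f) = delOp X t (delOp X s f) :=
  LinearMap.congr_fun (delOp_delOp X s t) f

theorem delOp_swap (X : Quadrant) (r s t u : Idx) (f : Osc) :
    delOp X r (delOp X s (delOp X t (delOp X u f))) =
      delOp X u (delOp X s (delOp X t (delOp X r f))) := by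
  rw [delOp_comm X t u, delOp_comm X s u, delOp_comm X r u, delOp_comm X r s, delOp_comm X r t]

theorem delOp_mul_quad (X : Quadrant) (r : Idx) (B : Matrix Idx Idx ℂ) :
    delOp X r * quad X B = quad X B * delOp X r + ∑ t, B r t • delOp X t := by
  change delOp X r * (∑ s, ∑ t, B s t • (coordOp X s * delOp X t)) =
    (∑ s, ∑ t, B s t • (coordOp X s * delOp X t)) * delOp X r + _
  have h : ∀ s t, delOp X r * (B s t • (coordOp X s * delOp X t)) =
      B s t • (coordOp X s * delOp X t) * delOp X r + if r = s then B s t • delOp X t else 0 := by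
    intro s t
    rw [mul_smul_comm, ← mul_assoc, delOp_coordOp, add_mul, mul_assoc, delOp_delOp, ← mul_assoc,
      smul_add, smul_mul_assoc]
    split_ifs <;> simp
  simp only [Finset.mul_sum, Finset.sum_mul, h, Finset.sum_add_distrib]
  congr 1
  rw [Finset.sum_comm]
  exact Finset.sum_congr rfl fun t _ => by simp

theorem delOp_quad (X : Quadrant) (r : Idx) (B : Matrix Idx Idx ℂ) (f : Osc) :
    delOp X r (quad X B f) = quad X B (delOp X r f) + ∑ t, B r t • delOp X t f := by
  have h := LinearMap.congr_fun (delOp_mul_quad X r B) f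
  simpa using h

theorem rho_eq_quad (X : Quadrant) (p : g0) (f : Osc) : rho X p f = quad X (toGl p) f := rfl

theorem delOp_delOp_rho (X : Quadrant) (r s : Idx) (p : g0) (f : Osc) :
    delOp X r (delOp X s (rho X p f)) = rho X p (delOp X r (delOp X s f)) +
      ∑ t, toGl p r t • delOp X t (delOp X s f) + ∑ t, toGl p s t • delOp X r (delOp X t f) := by
  simp only [rho_eq_quad, delOp_quad, map_add, map_sum, map_smul]

theorem rho_apply (X : Quadrant) (p : g0) (f : Osc) :
    rho X p f = ∑ s, ∑ t, p.1 s t • coordOp X (Sum.inl s) (delOp X (Sum.inl t) f) -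
      p.1.trace • ∑ m, coordOp X (Sum.inl m) (delOp X (Sum.inl m) f) +
      ∑ c, ∑ e, p.2.1 c e • coordOp X (Sum.inr c) (delOp X (Sum.inr e) f) +
      (p.1.trace / 2) • ∑ c, coordOp X (Sum.inr c) (delOp X (Sum.inr c) f) := by
  rw [rho_eq_quad]
  change (∑ s, ∑ t, toGl p s t • (coordOp X s * delOp X t)) f = _
  simp only [Fintype.sum_sum_type, toGl, Matrix.fromBlocks_apply₁₁, Matrix.fromBlocks_apply₁₂,
    Matrix.fromBlocks_apply₂₁, Matrix.fromBlocks_apply₂₂, Matrix.zero_apply, zero_smul,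
    Finset.sum_const_zero, add_zero, zero_add, LinearMap.add_apply, LinearMap.sum_apply,
    LinearMap.sub_apply, LinearMap.smul_apply, Module.End.mul_apply, Matrix.sub_apply,
    Matrix.add_apply,
    Matrix.smul_apply, Matrix.one_apply, sub_smul, add_smul, Finset.sum_sub_distrib,
    Finset.sum_add_distrib, smul_eq_mul, mul_ite, mul_one, mul_zero, ite_smul,
    Finset.sum_ite_eq, Finset.mem_univ, if_true, Finset.smul_sum]
  abel

/-- The operator `∂ᵢ∂_a`. -/
def delDel (X : Quadrant) (i : Fin 3) (a : Fin 2) : Module.End ℂ Osc :=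
  delOp X (Sum.inl i) * delOp X (Sum.inr a)

/-- The shifts `-tr` on the `xᵢ` and `+½ tr` on the `z_a` add up to `-½ tr`, the weight of `dᵢ^a`.
-/
theorem delDel_rho (X : Quadrant) (p : g0) (j : Fin 3) (b : Fin 2) (f : Osc) :
    delDel X j b (rho X p f) =
      rho X p (delDel X j b f) + ∑ i, ∑ a, coefD p j b i a • delDel X i a f := by
  change delOp X _ (delOp X _ (rho X p f)) =
    rho X p (delOp X _ (delOp X _ f)) + ∑ i, ∑ a, coefD p j b i a • delOp X _ (delOp X _ f)
  rw [delOp_delOp_rho, add_assoc]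
  congr 1
  simp only [Fintype.sum_sum_type, toGl, Matrix.fromBlocks_apply₁₁, Matrix.fromBlocks_apply₁₂,
    Matrix.fromBlocks_apply₂₁, Matrix.fromBlocks_apply₂₂, Matrix.zero_apply, zero_smul,
    Finset.sum_const_zero, add_zero, zero_add, coefD, Matrix.sub_apply, Matrix.add_apply,
    Matrix.smul_apply, Matrix.one_apply, sub_smul, add_smul, Finset.sum_sub_distrib,
    Finset.sum_add_distrib, smul_eq_mul, mul_ite, mul_one, mul_zero, ite_smul,
    Finset.sum_ite_eq, Finset.mem_univ, if_true]
  rw [Finset.sum_comm (s := Finset.univ (α := Fin 3)) (t := Finset.univ (α := Fin 2))]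
  simp only [Finset.sum_ite_eq, Finset.mem_univ, if_true]
  module

theorem sum_rho_oddDeg_delDel (X : Quadrant) (q : Fin 2 → Fin 3 → Fin 3 → ℂ)
    (w : Fin 2 → Fin 3 → ℂ) (hq : ∀ b l m, q b l m = q b m l) (f : Osc) :
    ∑ i, ∑ a, rho X (oddDeg q w i a) (delDel X i a f) = 0 := by
  have h := sum_oddDeg_one
    (fun s t i a => coordOp X (Sum.inl s) (delOp X (Sum.inl t) (delDel X i a f)))
    (fun c e i a => coordOp X (Sum.inr c) (delOp X (Sum.inr e) (delDel X i a f)))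
    (fun s t i a => congrArg _ (delOp_comm X (Sum.inl t) (Sum.inl i) _))
    (fun c e i a => by
      change coordOp X _ (delOp X _ (delOp X _ (delOp X _ f))) =
        coordOp X _ (delOp X _ (delOp X _ (delOp X _ f)))
      rw [delOp_comm X (Sum.inr e), delOp_comm X (Sum.inr e), delOp_comm X (Sum.inl i)]) q w hq
  rw [← h]
  exact Finset.sum_congr rfl fun i _ => Finset.sum_congr rfl fun a _ => rho_apply X _ _

/-- The morphism `∇ : M_X → M_X`. -/
theorem exists_nabla (X : Quadrant) :
    ∃ φ : M (V X) →ₗ[U] M (V X), ∀ f : V X,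
      φ (gen f) = ∑ i, ∑ a, ι (d i a) • gen (W := V X) (delDel X i a f) :=
  exists_hom_of_degree_one (V := V X) (W := V X) (fun i a => delDel X i a)
    (fun p j b f => delDel_rho X p j b f)
    (fun q w f hq => sum_rho_oddDeg_delDel X q w hq f)

theorem delOp_inl_mem (X : Quadrant) (i : Fin 3) {n : ℕ} {f : Osc} (hf : f ∈ homog n) :
    delOp X (Sum.inl i) f ∈ homog n := by
  unfold delOp
  split_ifs
  · exact derVar_mem _ hf rfl
  · have h := mulVar_mem (Sum.inl i) hf
    rwa [show wt (Sum.inl i) = 0 from rfl, zero_add] at h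

/-- The inclusion of a homogeneous component. -/
def toOsc (X : Quadrant) (n : ℕ) : Vdeg X n →ₗ[ℂ] Osc where
  toFun f := f.1
  map_add' _ _ := rfl
  map_smul' _ _ := rfl

theorem toOsc_injective (X : Quadrant) (n : ℕ) : Function.Injective (toOsc X n) :=
  Subtype.coe_injective

/-- The operator `∂ᵢ∂_a` on elements linear in `z_±`. -/
def delDelLinear (X : Quadrant) (hX : ∀ a, X.has (Sum.inr a) = true) (i : Fin 3) (a : Fin 2) :
    Vdeg X 1 →ₗ[ℂ] V' X where
  toFun f := ⟨delDel X i a f.1, by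
    change delOp X (Sum.inl i) (delOp X (Sum.inr a) (f.1 : Osc)) ∈ homog 0
    refine delOp_inl_mem X i ?_
    rw [delOp, if_pos (hX a)]
    exact derVar_mem _ f.2 rfl⟩
  map_add' f g := Subtype.ext (map_add (delDel X i a) f.1 g.1)
  map_smul' c f := Subtype.ext (map_smul (delDel X i a) c f.1)

/-- The restriction of `∇` to elements linear in `z_±`. -/
theorem exists_nabla_linear (X : Quadrant) (hX : ∀ a, X.has (Sum.inr a) = true) :
    ∃ φ : M (Vdeg X 1) →ₗ[U] M (V' X), ∀ f : Vdeg X 1,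
      φ (gen f) = ∑ i, ∑ a, ι (d i a) • gen (delDelLinear X hX i a f) := by
  refine exists_hom_of_degree_one (delDelLinear X hX) (fun p j b f => toOsc_injective _ 0 ?_)
    (fun q w f hq => toOsc_injective _ 0 ?_)
  · refine (delDel_rho X p j b f.1).trans ?_
    symm
    simp only [map_add, map_sum, map_smul]
    rfl
  · rw [map_zero]
    refine Eq.trans ?_ (sum_rho_oddDeg_delDel X q w hq f.1)
    simp only [map_sum]
    rfl

/-! ### Elements free of the `z`-variables and the morphism `∇₂` -/

theorem pderiv_inr_of_isWeightedHomogeneous {g : Poly}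
    (hg : MvPolynomial.IsWeightedHomogeneous wt g 0) (c : Fin 2) :
    MvPolynomial.pderiv (Sum.inr c) g = 0 := by
  ext m
  rw [MvPolynomial.coeff_pderiv, MvPolynomial.coeff_zero, hg.coeff_eq_zero, zero_mul]
  rw [map_add, Finsupp.weight_single]
  simp [wt]

theorem derVar_inr_of_mem {f : Osc} (hf : f ∈ homog 0) (c : Fin 2) : derVar (Sum.inr c) f = 0 :=
  pderiv_inr_of_isWeightedHomogeneous hf c

theorem coordOp_delOp_inr_of_has {X : Quadrant} (hX : ∀ a, X.has (Sum.inr a) = true) {f : Osc}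
    (hf : f ∈ homog 0) (c e : Fin 2) : coordOp X (Sum.inr c) (delOp X (Sum.inr e) f) = 0 := by
  rw [delOp, if_pos (hX e), derVar_inr_of_mem hf, map_zero]

/-- With `z_c 1 = 0`, commuting `z_c` past `∂_e` leaves the constant `-δ`. Summed over both values
of `c` and halved, this produces the extra `-tr` in `rho_apply_of_not_has`. -/
theorem coordOp_delOp_inr_of_not_has {X : Quadrant} (hX : ∀ a, X.has (Sum.inr a) = false)
    {f : Osc} (hf : f ∈ homog 0) (c e : Fin 2) :
    coordOp X (Sum.inr c) (delOp X (Sum.inr e) f) = if c = e then - f else 0 := by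
  have h := LinearMap.congr_fun (der_mul (Sum.inr c) (Sum.inr e)) f
  simp only [Module.End.mul_apply, LinearMap.add_apply, derVar_inr_of_mem hf, map_zero,
    zero_add] at h
  rw [delOp, coordOp, hX, hX]
  simp only [Bool.false_eq_true, if_false, LinearMap.neg_apply, h]
  by_cases hc : c = e <;> simp [hc]

theorem rho_apply_of_has {X : Quadrant} (hX : ∀ a, X.has (Sum.inr a) = true) {f : Osc}
    (hf : f ∈ homog 0) (p : g0) :
    rho X p f = ∑ s, ∑ t, p.1 s t • coordOp X (Sum.inl s) (delOp X (Sum.inl t) f) -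
      p.1.trace • ∑ m, coordOp X (Sum.inl m) (delOp X (Sum.inl m) f) := by
  rw [rho_apply]
  simp only [coordOp_delOp_inr_of_has hX hf, smul_zero, Finset.sum_const_zero, add_zero]

theorem rho_apply_of_not_has {X : Quadrant} (hX : ∀ a, X.has (Sum.inr a) = false) {f : Osc}
    (hf : f ∈ homog 0) (p : g0) :
    rho X p f = ∑ s, ∑ t, p.1 s t • coordOp X (Sum.inl s) (delOp X (Sum.inl t) f) -
      p.1.trace • (∑ m, coordOp X (Sum.inl m) (delOp X (Sum.inl m) f) + f) := by
  have ht : p.2.1 0 0 + p.2.1 1 1 = 0 := by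
    have h : p.2.1.trace = 0 := p.2.2
    rwa [Matrix.trace_fin_two] at h
  have h1 : ∑ c, ∑ e, p.2.1 c e • coordOp X (Sum.inr c) (delOp X (Sum.inr e) f) = 0 := by
    simp only [coordOp_delOp_inr_of_not_has hX hf, Fin.sum_univ_two]
    rw [eq_neg_of_add_eq_zero_right ht]
    simp
  rw [rho_apply, h1]
  simp only [coordOp_delOp_inr_of_not_has hX hf, if_true, Fin.sum_univ_two]
  module

theorem coordOp_inl_eq {X Y : Quadrant} (h : ∀ i, X.has (Sum.inl i) = Y.has (Sum.inl i))
    (i : Fin 3) : coordOp X (Sum.inl i) = coordOp Y (Sum.inl i) := by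
  rw [coordOp, coordOp, h]

theorem delOp_inl_eq {X Y : Quadrant} (h : ∀ i, X.has (Sum.inl i) = Y.has (Sum.inl i))
    (i : Fin 3) : delOp X (Sum.inl i) = delOp Y (Sum.inl i) := by
  rw [delOp, delOp, h]

theorem rho_eq_rho_sub {X Y : Quadrant} (hX : ∀ a, X.has (Sum.inr a) = true)
    (hY : ∀ a, Y.has (Sum.inr a) = false) (h : ∀ i, X.has (Sum.inl i) = Y.has (Sum.inl i))
    {f : Osc} (hf : f ∈ homog 0) (p : g0) : rho X p f = rho Y p f + p.1.trace • f := by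
  rw [rho_apply_of_has hX hf, rho_apply_of_not_has hY hf]
  simp only [coordOp_inl_eq h, delOp_inl_eq h]
  module

/-- Each derivative contributes `-tr` and the change of module `+tr`, so the total is the weight
`-tr` of `dᵢ⁻ d_j⁺`. -/
theorem del_del_rho {X Y : Quadrant} (hX : ∀ a, X.has (Sum.inr a) = true)
    (hY : ∀ a, Y.has (Sum.inr a) = false) (h : ∀ i, X.has (Sum.inl i) = Y.has (Sum.inl i))
    {f : Osc} (hf : f ∈ homog 0) (p : g0) (k l : Fin 3) :
    delOp Y (Sum.inl k) (delOp Y (Sum.inl l) (rho X p f)) =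
      rho Y p (delOp Y (Sum.inl k) (delOp Y (Sum.inl l) f)) +
      ∑ i, p.1 k i • delOp Y (Sum.inl i) (delOp Y (Sum.inl l) f) +
      ∑ j, p.1 l j • delOp Y (Sum.inl k) (delOp Y (Sum.inl j) f) -
      p.1.trace • delOp Y (Sum.inl k) (delOp Y (Sum.inl l) f) := by
  rw [rho_eq_rho_sub hX hY h hf, map_add, map_add, delOp_delOp_rho]
  simp only [Fintype.sum_sum_type, toGl, Matrix.fromBlocks_apply₁₁, Matrix.fromBlocks_apply₁₂,
    Matrix.zero_apply, zero_smul, Finset.sum_const_zero, add_zero, Matrix.sub_apply,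
    Matrix.smul_apply, Matrix.one_apply, sub_smul, Finset.sum_sub_distrib,
    smul_eq_mul, mul_ite, mul_one, mul_zero, ite_smul, Finset.sum_ite_eq, Finset.mem_univ, if_true,
    map_smul]
  module

/-- The operator `f 1_X ↦ (∂ᵢ∂_j f) 1_Y`. -/
def delDelTransfer (X Y : Quadrant) (i j : Fin 3) : V' X →ₗ[ℂ] V' Y :=
  (dx' Y i).comp ((dx' Y j).comp (transfer X Y))

/-- The morphism `∇₂`, for `(X, Y) = (A, B)` and `(C, D)`. -/
theorem exists_nabla2 {X Y : Quadrant} (hX : ∀ a, X.has (Sum.inr a) = true)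
    (hY : ∀ a, Y.has (Sum.inr a) = false) (h : ∀ i, X.has (Sum.inl i) = Y.has (Sum.inl i)) :
    ∃ φ : M (V' X) →ₗ[U] M (V' Y), ∀ f : V' X,
      φ (gen f) = ∑ i, ∑ j, ι (d i 1) • ι (d j 0) • gen (delDelTransfer X Y i j f) := by
  have hm : ∀ (f : V' X) i j, delOp Y (Sum.inl i) (delOp Y (Sum.inl j) (f.1 : Osc)) ∈ homog 0 :=
    fun f i j => delOp_inl_mem Y i (delOp_inl_mem Y j f.2)
  let T : V' X → Fin 3 → Fin 3 → Fin 3 → Fin 3 → Osc := fun f s t i j =>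
    coordOp Y (Sum.inl s)
      (delOp Y (Sum.inl t) (delOp Y (Sum.inl i) (delOp Y (Sum.inl j) (f.1 : Osc))))
  let Q : V' X → Fin 3 → Fin 3 → Osc := fun f i j =>
    delOp Y (Sum.inl i) (delOp Y (Sum.inl j) (f.1 : Osc))
  have hT : ∀ f s t i j, T f s t i j = T f s i t j := fun f s t i j =>
    congrArg _ (delOp_comm Y (Sum.inl t) (Sum.inl i) _)
  have hT' : ∀ f s t i j, T f s t i j = T f s t j i := fun f s t i j =>
    congrArg (fun g => coordOp Y (Sum.inl s) (delOp Y (Sum.inl t) g))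
      (delOp_comm Y (Sum.inl i) (Sum.inl j) _)
  have hQ : ∀ f i j, Q f i j = Q f j i := fun f i j => delOp_comm Y _ _ _
  have hr : ∀ f i j (p : g0), rho Y p (Q f i j) = ∑ s, ∑ t, p.1 s t • T f s t i j -
      p.1.trace • (∑ m, T f m m i j + Q f i j) := fun f i j p =>
    rho_apply_of_not_has hY (hm f i j) p
  refine exists_hom_of_degree_two (delDelTransfer X Y)
    (fun i j => LinearMap.ext fun f => Subtype.ext (hQ f i j))
    (fun p k l f => toOsc_injective _ 0 ?_) (fun D φ μ q w f hD hq hw => toOsc_injective _ 0 ?_)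
    (fun q w f k hq => toOsc_injective _ 0 ?_) (fun q w f k hq => toOsc_injective _ 0 ?_)
  · refine (del_del_rho hX hY h f.2 p k l).trans ?_
    symm
    simp only [map_add, map_sub, map_sum, map_smul]
    rfl
  · rw [map_zero]
    refine Eq.trans ?_ (sum_oddDeg_two (T f) (Q f) (hT f) (hT' f) (hQ f) D φ μ q w hD hq hw)
    simp only [← hr]
    simp only [map_sum]
    rfl
  · rw [map_zero]
    refine Eq.trans ?_ (sum_coefD_sub (T f) (Q f) (hT f) (hT' f) (hQ f) q w hq k)
    simp only [← hr]
    simp only [map_sub, map_sum, map_smul]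
    rfl
  · rw [map_zero]
    refine Eq.trans ?_ (sum_coefD_add (T f) (Q f) (hT f) (hT' f) (hQ f) q w hq k)
    simp only [← hr]
    simp only [map_add, map_sum, map_smul]
    rfl

/-! ### Compositions -/

/-- In `Δ⁻Δ⁺Δ^a` the case `a = +` contains `(Δ⁺)²`, and for `a = -` it equals `-(Δ⁻)²Δ⁺`. As
morphisms act on the right of `u`, the factors of the map applied first stand on the left. -/
theorem nabla_nabla2_sum {N : Type} [AddCommGroup N] [Module U N]
    (T : Fin 3 → Fin 3 → Fin 3 → Fin 2 → N) (hT : ∀ i j k a, T i j k a = T j i k a)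
    (hT' : ∀ i j k a, T i j k a = T i k j a) :
    ∑ i, ∑ j, ι (d i 1) • ι (d j 0) • ∑ k, ∑ a, ι (d k a) • T i j k a = 0 := by
  have h0 : ∀ i, ∑ j, ∑ k, ι (d j 0) • ι (d k 0) • T i j k 0 = 0 := fun i =>
    sum_ι_d_d_self 0 _ fun j k => hT' i j k 0
  have h1 : ∀ i, ∑ j, ∑ k, ι (d j 0) • ι (d k 1) • T i j k 1 =
      - ∑ j, ∑ k, ι (d j 1) • ι (d k 0) • T i j k 1 := fun i =>
    sum_ι_d_d_anticomm 0 1 _ fun j k => hT' i j k 1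
  have h2 : ∑ i, ∑ j, ι (d i 1) • ι (d j 1) • ∑ k, ι (d k 0) • T i j k 1 = 0 :=
    sum_ι_d_d_self 1 _ fun i j => by simp only [hT i j]
  have h3 : ∀ i, ∑ j, ι (d j 0) • ∑ k, ∑ a, ι (d k a) • T i j k a =
      - ∑ j, ι (d j 1) • ∑ k, ι (d k 0) • T i j k 1 := by
    intro i
    simp only [Fin.sum_univ_two, smul_add, Finset.smul_sum, Finset.sum_add_distrib, h0 i, h1 i,
      zero_add]
  simp only [← Finset.smul_sum, h3, smul_neg, Finset.sum_neg_distrib]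
  simp only [Finset.smul_sum (s := Finset.univ (α := Fin 3)) (f := fun j => ι (d j 1) • _), h2,
    neg_zero]

/-- In `Δ^aΔ⁻Δ⁺` the case `a = -` contains `(Δ⁻)²`, and for `a = +` it equals `-Δ⁻(Δ⁺)²`. -/
theorem nabla2_nabla_sum {N : Type} [AddCommGroup N] [Module U N]
    (T : Fin 3 → Fin 2 → Fin 3 → Fin 3 → N) (hT : ∀ k a i j, T k a i j = T i a k j)
    (hT' : ∀ k a i j, T k a i j = T k a j i) :
    ∑ k, ∑ a, ι (d k a) • ∑ i, ∑ j, ι (d i 1) • ι (d j 0) • T k a i j = 0 := by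
  have h1 : ∑ k, ∑ i, ι (d k 1) • ι (d i 1) • ∑ j, ι (d j 0) • T k 1 i j = 0 :=
    sum_ι_d_d_self 1 _ fun k i => by simp only [hT k 1 i]
  have h0 : ∑ k, ∑ i, ι (d k 0) • ι (d i 1) • ∑ j, ι (d j 0) • T k 0 i j =
      - ∑ k, ∑ i, ι (d k 1) • ι (d i 0) • ∑ j, ι (d j 0) • T k 0 i j :=
    sum_ι_d_d_anticomm 0 1 _ fun k i => by simp only [hT k 0 i]
  have h2 : ∀ k, ∑ i, ∑ j, ι (d i 0) • ι (d j 0) • T k 0 i j = 0 := fun k =>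
    sum_ι_d_d_self 0 _ fun i j => hT' k 0 i j
  have h3 : ∑ k, ∑ i, ι (d k 1) • ι (d i 0) • ∑ j, ι (d j 0) • T k 0 i j = 0 := by
    refine Finset.sum_eq_zero fun k _ => ?_
    rw [← Finset.smul_sum]
    simp only [Finset.smul_sum (s := Finset.univ (α := Fin 3)) (f := fun j => ι (d j 0) • _), h2,
      smul_zero]
  simp only [Fin.sum_univ_two, Finset.sum_add_distrib, Finset.smul_sum] at h0 h1 h3 ⊢
  rw [h0, h1, h3, neg_zero, add_zero]

theorem evalAt_nabla (X : Quadrant) (f : V X) :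
    evalAt (nabla X) f = ∑ i, ∑ a, ι (d i a) • gen (W := V X) (delDel X i a f) := by
  simp only [nabla, evalAt_sum]
  exact Finset.sum_congr rfl fun i _ => Finset.sum_congr rfl fun a _ => evalAt_tmul _ _ _

theorem evalAt_nabla2 (X Y : Quadrant) (f : V' X) :
    evalAt (nabla2 Y) (transfer X Y f) =
      ∑ i, ∑ j, ι (d i 1) • ι (d j 0) • gen (delDelTransfer X Y i j f) := by
  -- The product in `U ⊗ End` multiplies both factors in the same order, so `Δ⁻Δ⁺` has `dᵢ⁻ d_j⁺`
  -- paired with `∂ᵢ∂_j`.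
  have h : nabla2 Y = ∑ i, ∑ j, (ι (d i 1) * ι (d j 0)) ⊗ₜ[ℂ] (dx' Y i * dx' Y j) := by
    simp only [nabla2, Delta, Finset.sum_mul_sum, Algebra.TensorProduct.tmul_mul_tmul]
  rw [h, evalAt_sum]
  refine Finset.sum_congr rfl fun i _ => ?_
  rw [evalAt_sum]
  refine Finset.sum_congr rfl fun j _ => ?_
  rw [smul_smul]
  exact evalAt_tmul _ _ _

theorem nabla_comp_nabla2 {X Y : Quadrant} {φ : M (V Y) →ₗ[U] M (V Y)}
    {ψ : M (V' X) →ₗ[U] M (V' Y)}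
    (hφ : ∀ f : V Y, φ (gen f) = ∑ i, ∑ a, ι (d i a) • gen (W := V Y) (delDel Y i a f))
    (hψ : ∀ f : V' X,
      ψ (gen f) = ∑ i, ∑ j, ι (d i 1) • ι (d j 0) • gen (delDelTransfer X Y i j f)) :
    φ ∘ₗ M.map (V' Y).incl ∘ₗ ψ = 0 := by
  refine M.hom_ext fun f => ?_
  change φ (M.map (V' Y).incl (ψ (gen f))) = 0
  rw [hψ]
  simp only [map_sum, map_smul, M.map_gen, hφ]
  have hc := delOp_comm Y
  refine nabla_nabla2_sum (fun i j k a => gen (W := V Y)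
    (delDel Y k a ((V' Y).incl (delDelTransfer X Y i j f)))) (fun i j k a => congrArg _ ?_)
    (fun i j k a => congrArg _ ?_)
  · exact congrArg (delDel Y k a) (hc (Sum.inl i) (Sum.inl j) (f.1 : Osc))
  · exact delOp_swap Y (Sum.inl k) (Sum.inr a) (Sum.inl i) (Sum.inl j) f.1

theorem nabla2_comp_nabla {X Y : Quadrant} (hX : ∀ a, X.has (Sum.inr a) = true)
    (h : ∀ i, X.has (Sum.inl i) = Y.has (Sum.inl i))
    {φ : M (Vdeg X 1) →ₗ[U] M (V' X)} {ψ : M (V' X) →ₗ[U] M (V' Y)}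
    (hφ : ∀ f, φ (gen f) = ∑ i, ∑ a, ι (d i a) • gen (delDelLinear X hX i a f))
    (hψ : ∀ f : V' X,
      ψ (gen f) = ∑ i, ∑ j, ι (d i 1) • ι (d j 0) • gen (delDelTransfer X Y i j f)) :
    ψ ∘ₗ φ = 0 := by
  refine M.hom_ext fun f => ?_
  change ψ (φ (gen f)) = 0
  rw [hφ]
  simp only [map_sum, map_smul, hψ]
  have hc := delOp_comm Y
  refine nabla2_nabla_sum (fun k a i j => gen (delDelTransfer X Y i j (delDelLinear X hX k a f)))
    (fun k a i j => congrArg _ (Subtype.ext ?_)) (fun k a i j => congrArg _ (Subtype.ext ?_))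
  · change delOp Y (Sum.inl i) (delOp Y (Sum.inl j) (delOp X (Sum.inl k) _)) =
      delOp Y (Sum.inl k) (delOp Y (Sum.inl j) (delOp X (Sum.inl i) _))
    rw [delOp_inl_eq h, delOp_inl_eq h, hc (Sum.inl j), hc (Sum.inl j), hc (Sum.inl i)]
  · exact hc (Sum.inl i) (Sum.inl j) _

theorem map_incl_comp_nabla_linear {X : Quadrant} (hX : ∀ a, X.has (Sum.inr a) = true)
    {φ : M (V X) →ₗ[U] M (V X)} {ψ : M (Vdeg X 1) →ₗ[U] M (V' X)}
    (hφ : ∀ f : V X, φ (gen f) = ∑ i, ∑ a, ι (d i a) • gen (W := V X) (delDel X i a f))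
    (hψ : ∀ f, ψ (gen f) = ∑ i, ∑ a, ι (d i a) • gen (delDelLinear X hX i a f)) :
    M.map (V' X).incl ∘ₗ ψ = φ ∘ₗ M.map (Vdeg X 1).incl := by
  refine M.hom_ext fun f => ?_
  change M.map (V' X).incl (ψ (gen f)) = φ (M.map (Vdeg X 1).incl (gen f))
  rw [hψ, M.map_gen, hφ]
  simp only [map_sum, map_smul, M.map_gen]
  rfl

end Exceptional

end

theorem proposition3p3 :
    ∃ (nab : ∀ X : Quadrant, M (V X) →ₗ[U] M (V X))
      (nab₂AB : M (V' Quadrant.A) →ₗ[U] M (V' Quadrant.B))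
      (nab₂CD : M (V' Quadrant.C) →ₗ[U] M (V' Quadrant.D)),
      (∀ X, GivenBy (nab X) (nabla X) LinearMap.id) ∧
      GivenBy nab₂AB (nabla2 Quadrant.B) (transfer Quadrant.A Quadrant.B) ∧
      GivenBy nab₂CD (nabla2 Quadrant.D) (transfer Quadrant.C Quadrant.D) ∧
      nab Quadrant.B ∘ₗ M.map (V' Quadrant.B).incl ∘ₗ nab₂AB = 0 ∧
      nab Quadrant.D ∘ₗ M.map (V' Quadrant.D).incl ∘ₗ nab₂CD = 0 ∧
      (∃ nabA : M (Vdeg Quadrant.A 1) →ₗ[U] M (V' Quadrant.A),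
        M.map (V' Quadrant.A).incl ∘ₗ nabA =
          nab Quadrant.A ∘ₗ M.map (Vdeg Quadrant.A 1).incl ∧
        nab₂AB ∘ₗ nabA = 0) ∧
      (∃ nabC : M (Vdeg Quadrant.C 1) →ₗ[U] M (V' Quadrant.C),
        M.map (V' Quadrant.C).incl ∘ₗ nabC =
          nab Quadrant.C ∘ₗ M.map (Vdeg Quadrant.C 1).incl ∧
        nab₂CD ∘ₗ nabC = 0) := by
  have hA : ∀ a, Quadrant.A.has (Sum.inr a) = true := fun _ => rfl
  have hC : ∀ a, Quadrant.C.has (Sum.inr a) = true := fun _ => rfl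
  have hAB : ∀ i, Quadrant.A.has (Sum.inl i) = Quadrant.B.has (Sum.inl i) := fun _ => rfl
  have hCD : ∀ i, Quadrant.C.has (Sum.inl i) = Quadrant.D.has (Sum.inl i) := fun _ => rfl
  choose nab hnab using exists_nabla
  obtain ⟨nab₂AB, hnabAB⟩ := exists_nabla2 (Y := Quadrant.B) hA (fun _ => rfl) hAB
  obtain ⟨nab₂CD, hnabCD⟩ := exists_nabla2 (Y := Quadrant.D) hC (fun _ => rfl) hCD
  obtain ⟨nabA, hnabA⟩ := exists_nabla_linear Quadrant.A hA
  obtain ⟨nabC, hnabC⟩ := exists_nabla_linear Quadrant.C hC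
  exact ⟨nab, nab₂AB, nab₂CD,
    fun X => givenBy_of_gen fun f => (hnab X f).trans (evalAt_nabla X f).symm,
    givenBy_of_gen fun f => (hnabAB f).trans (evalAt_nabla2 _ _ f).symm,
    givenBy_of_gen fun f => (hnabCD f).trans (evalAt_nabla2 _ _ f).symm,
    nabla_comp_nabla2 (hnab _) hnabAB, nabla_comp_nabla2 (hnab _) hnabCD,
    ⟨nabA, map_incl_comp_nabla_linear hA (hnab _) hnabA, nabla2_comp_nabla hA hAB hnabA hnabAB⟩,
    ⟨nabC, map_incl_comp_nabla_linear hC (hnab _) hnabC, nabla2_comp_nabla hC hCD hnabC hnabCD⟩⟩
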